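/- Let $I=[-\frac12,\frac12]$ and let $f\colon I\setminus\{0\}\to I$ be a one-dimensional Lorenz map, that is, a $C^2$ map (one-sided derivatives at $\pm\frac12$) such that - $\lim_{x\to0^-}f(x)=\frac12$ and $\lim_{x\to0^+}f(x)=-\frac12$; - $f'(x)>\sqrt2$ for all $x\in I\setminus\{0\}$, and $f'(x)\to+\infty$ as $x\to0^-$ and as $x\to 0^+$; - there are $\alpha\in(0,1)$ and constants $C,C_1>1$ such that, for all $x\in I\setminus\{0\}$, $$\frac1C\le\frac{f'(x)}{|x|^{\alpha-1}}\le C,\qquad \frac{|f''(x)|}{|x|^{\alpha-2}}\le C_1 .$$ (For instance, the quotient map of the geometric Lorenz attractor: $f(x)=\theta x^\alpha-\frac12$ for $x>0$ and $f(x)=\frac12-\theta|x|^\alpha$ for $x<0$, with $0<\alpha<1$, $\theta 2^{-\alpha}<1$ and $2\alpha\,\theta 2^{-\alpha}>\sqrt2$.) A regular (dynamically defined) Cantor set is a Cantor set $K\subset\mathbb R$ for which there are pairwise disjoint compact non-degenerate intervals $I_1,\dots,I_r$ with $K\subset I_1\cup\dots\cup I_r$ and $\partial I_j\subset K$ for all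 $j$, and an expanding map $\psi$ ($|\psi'|\ge\lambda$ for some $\lambda>1$) of class $C^{1+\varepsilon}$, for some $\varepsilon\in(0,1]$, defined on a neighbourhood of $I_1\cup\dots\cup I_r$, such that for every $j$ the image $\psi(I_j)$ is the convex hull of a union of some of the $I_s$ and $\psi^n(K\cap I_j)=K$ for all sufficiently large $n$, and $K=\bigcap_{n\ge0}\psi^{-n}(I_1\cup\dots\cup I_r)$. It is a regular Cantor set for $f$ if moreover, for every $j$, the map $\psi$ coincides on a neighbourhood $V_j$ of $I_j$ with an iterate $f^{n_j}$, $n_j\ge1$, where $f^i(V_j)\subset I\setminus\{0\}$ for $0\le i<n_j$. Then there is an increasing sequence $C_1\subset C_2\subset\cdots$ of regular Cantor sets for $f$ with Hausdorff dimensions $HD(C_k)\to1$ as $k\to\infty$. -/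

import Mathlib

open Set Filter Topology
open scoped NNReal

namespace Lorenz

/-- The domain `I \ {0}` of the one-dimensional map, where `I = [-1/2, 1/2]`. -/
def dom : Set ℝ := Icc (-1 / 2) (1 / 2) \ {0}

/-- `f : I \ {0} → I` is a one-dimensional Lorenz map with exponent `α`. Values of `f` outside
`I \ {0}` play no role; at the end points `±1/2` of `I` derivatives are one-sided. -/
structure IsLorenzMap (f : ℝ → ℝ) (α : ℝ) : Prop where
  alpha_pos : 0 < α
  alpha_lt_one : α < 1
  mapsTo : MapsTo f dom (Icc (-1 / 2) (1 / 2))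
  contDiffOn : ContDiffOn ℝ 2 f dom
  /-- `f(0⁻) = 1/2` -/
  lim_left : Tendsto f (𝓝[<] 0) (𝓝 (1 / 2))
  /-- `f(0⁺) = -1/2` -/
  lim_right : Tendsto f (𝓝[>] 0) (𝓝 (-1 / 2))
  sqrt_two_lt_deriv : ∀ x ∈ dom, √2 < derivWithin f dom x
  deriv_lim_left : Tendsto (derivWithin f dom) (𝓝[<] 0) atTop
  deriv_lim_right : Tendsto (derivWithin f dom) (𝓝[>] 0) atTop
  /-- `f'` is comparable with `|x|^(α-1)` -/
  deriv_bounds : ∃ C : ℝ, 1 < C ∧ ∀ x ∈ dom,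
    1 / C ≤ derivWithin f dom x / |x| ^ (α - 1) ∧ derivWithin f dom x / |x| ^ (α - 1) ≤ C
  /-- `|f''|` is at most a constant times `|x|^(α-2)` -/
  deriv2_bound : ∃ C₁ : ℝ, 1 < C₁ ∧ ∀ x ∈ dom,
    |derivWithin (derivWithin f dom) dom x| / |x| ^ (α - 2) ≤ C₁

/-- Cantor sets on the line. -/
structure IsCantorSet (K : Set ℝ) : Prop where
  nonempty : K.Nonempty
  isCompact : IsCompact K
  perfect : Perfect K
  totallyDisconnected : IsTotallyDisconnected K

/-- `K` is a regular (dynamically defined) Cantor set with Markov partition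
`[a j, b j]`, `j = 1, …, r`, defined by the expanding `C^{1+ε}` map `ψ`. -/
structure IsRegularCantorSetWith (K : Set ℝ) {r : ℕ} (a b : Fin r → ℝ) (ψ : ℝ → ℝ) :
    Prop where
  isCantorSet : IsCantorSet K
  lt : ∀ j, a j < b j
  disjoint : Pairwise fun i j => Disjoint (Icc (a i) (b i)) (Icc (a j) (b j))
  subset : K ⊆ ⋃ j, Icc (a j) (b j)
  left_mem : ∀ j, a j ∈ K
  right_mem : ∀ j, b j ∈ K
  /-- `ψ` is of class `C^{1+ε}` and expanding on a neighbourhood `U` of the intervals -/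
  expanding : ∃ U : Set ℝ, IsOpen U ∧ (⋃ j, Icc (a j) (b j)) ⊆ U ∧
    DifferentiableOn ℝ ψ U ∧
    (∃ C ε : ℝ≥0, 0 < ε ∧ ε ≤ 1 ∧ HolderOnWith C ε (deriv ψ) U) ∧
    ∃ l : ℝ, 1 < l ∧ ∀ x ∈ U, l ≤ |deriv ψ x|
  markov : ∀ j, ∃ S : Finset (Fin r),
    ψ '' Icc (a j) (b j) = convexHull ℝ (⋃ s ∈ S, Icc (a s) (b s))
  mixing : ∀ j, ∃ N : ℕ, ∀ n ≥ N, ψ^[n] '' (K ∩ Icc (a j) (b j)) = K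
  maximal : K = ⋂ n : ℕ, ψ^[n] ⁻¹' (⋃ j, Icc (a j) (b j))

/-- `K` is a regular Cantor set for `f`: it is defined by a map which, near each interval of
the Markov partition, is an iterate of `f` whose intermediate orbits stay in `I \ {0}`. -/
def IsRegularCantorSetFor (f : ℝ → ℝ) (K : Set ℝ) : Prop :=
  ∃ (r : ℕ) (a b : Fin r → ℝ) (ψ : ℝ → ℝ), IsRegularCantorSetWith K a b ψ ∧
    ∀ j, ∃ n : ℕ, 1 ≤ n ∧ ∃ V : Set ℝ, IsOpen V ∧ Icc (a j) (b j) ⊆ V ∧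
      ∀ x ∈ V, (∀ i < n, f^[i] x ∈ dom) ∧ ψ x = f^[n] x

end Lorenz

/-! The Cantor sets are horseshoes: finitely many disjoint intervals inside `(p, q)`, each mapped by
an iterate of `f` increasingly onto `(p, q)`. The limit set of such a system is a regular Cantor set
(`isRegularCantorSetWith_limitSet`). If the inverse branches shrink distances at most by factors `κ
i` with `∑ κ i ^ s ≥ 1`, then the self-similar coordinate with weights proportional to `κ i ^ s` is
an `s`-Hölder map of the limit set onto `[0, 1]`, so the dimension is at least `s`
(`le_dimH_limitSet`).

For `s < 1` such a horseshoe is found inside any given interval (`exists_horseshoe`). Follow an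
interval under `f`, discarding at each step the points that fall into `(-δ, δ)` and cutting images
into pieces of length at most `η = δ ^ α`. Since `|f''| / f' ^ 2 ≤ M |x| ^ (-α)`, the branches
obtained have distortion at most `exp (4 * M)`, whatever `δ` is (`distortion`). A growth estimate
(`exists_step`, `exists_family`) bounds the sum of the inverse Lipschitz constants by a multiple of
the surviving length over `η`. The proportion lost per step is therefore `O(δ / η) = O(δ ^ (1 -
α))`, which is small because `α < 1`. After `n` steps a length at least `(1 - ε) ^ n * η` survives,
in pieces of length at most `(5 / 7) ^ n`.

Half of this length lies in pieces whose image is not too short, and each such image contains a full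
branch onto `[p, q]`: slope larger than `√2` makes every interval grow until it covers one
(`hasFullBranch`), and the Lipschitz constant of that branch does not depend on `n`
(`hasFullBranch_uniform`). So `∑ κ i ^ s` is at least a constant times `((1 - ε) * (7 / 5) ^ (1 -
s)) ^ n`, which is large once `ε` is small and then `n` is large.

Finally, horseshoes with `s → 1` are placed in disjoint subintervals of `(1/8, 3/8)`, all with this
same target. Any finite union of them is again a full branch system, which gives a nested sequence.
-/

namespace Lorenz

/-! ### Systems of full branches on the line -/

/-- The map `ψ` sends each of the disjoint intervals `(a i, b i)`, compactly contained in `(p, q)`,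
increasingly onto `(p, q)`, and expands distances by the factor `lam > 1`. -/
structure IsFullBranchSystem (ψ : ℝ → ℝ) (lam p q : ℝ) {ι : Type*} (a b : ι → ℝ) : Prop where
  one_lt : 1 < lam
  left_lt : ∀ i, p < a i
  lt : ∀ i, a i < b i
  lt_right : ∀ i, b i < q
  disjoint : Pairwise fun i j => Disjoint (Ioo (a i) (b i)) (Ioo (a j) (b j))
  continuousOn : ∀ i, ContinuousOn ψ (Ioo (a i) (b i))
  mapsTo : ∀ i, MapsTo ψ (Ioo (a i) (b i)) (Ioo p q)
  surjOn : ∀ i, SurjOn ψ (Ioo (a i) (b i)) (Ioo p q)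
  expand : ∀ i, ∀ x ∈ Ioo (a i) (b i), ∀ y ∈ Ioo (a i) (b i), x ≤ y →
    lam * (y - x) ≤ ψ y - ψ x

/-- The points whose `ψ`-orbits never leave the intervals `(a i, b i)`. -/
def limitSet (ψ : ℝ → ℝ) {ι : Type*} (a b : ι → ℝ) : Set ℝ :=
  {x | ∀ n : ℕ, ψ^[n] x ∈ ⋃ i, Ioo (a i) (b i)}

theorem mem_limitSet_iff {ψ : ℝ → ℝ} {ι : Type*} {a b : ι → ℝ} {x : ℝ} :
    x ∈ limitSet ψ a b ↔ (∃ i, x ∈ Ioo (a i) (b i)) ∧ ψ x ∈ limitSet ψ a b := by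
  constructor
  · intro h
    refine ⟨by simpa using h 0, fun n => ?_⟩
    have := h (n + 1)
    rwa [Function.iterate_succ_apply] at this
  · rintro ⟨⟨i, hi⟩, h⟩ n
    cases n with
    | zero => exact mem_iUnion.2 ⟨i, hi⟩
    | succ n =>
      rw [Function.iterate_succ_apply]
      exact h n

theorem mem_limitSet_of_apply {ψ : ℝ → ℝ} {ι : Type*} {a b : ι → ℝ} {x : ℝ} {i : ι}
    (hi : x ∈ Ioo (a i) (b i)) (h : ψ x ∈ limitSet ψ a b) : x ∈ limitSet ψ a b :=
  mem_limitSet_iff.2 ⟨⟨i, hi⟩, h⟩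

theorem mem_limitSet_of_fixed {ψ : ℝ → ℝ} {ι : Type*} {a b : ι → ℝ} {x : ℝ} {i : ι}
    (hi : x ∈ Ioo (a i) (b i)) (h : ψ x = x) : x ∈ limitSet ψ a b := by
  intro n
  rw [Function.iterate_fixed h]
  exact mem_iUnion.2 ⟨i, hi⟩

namespace IsFullBranchSystem

variable {ψ : ℝ → ℝ} {lam p q : ℝ} {ι : Type*} {a b : ι → ℝ}

theorem Ioo_subset (h : IsFullBranchSystem ψ lam p q a b) (i : ι) :
    Ioo (a i) (b i) ⊆ Ioo p q :=
  Ioo_subset_Ioo (h.left_lt i).le (h.lt_right i).le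

theorem left_mem (h : IsFullBranchSystem ψ lam p q a b) (i : ι) : a i ∈ Ioo p q :=
  ⟨h.left_lt i, (h.lt i).trans (h.lt_right i)⟩

theorem right_mem (h : IsFullBranchSystem ψ lam p q a b) (i : ι) : b i ∈ Ioo p q :=
  ⟨(h.left_lt i).trans (h.lt i), h.lt_right i⟩

theorem expand_abs (h : IsFullBranchSystem ψ lam p q a b) {i : ι} {x y : ℝ}
    (hx : x ∈ Ioo (a i) (b i)) (hy : y ∈ Ioo (a i) (b i)) :
    lam * |y - x| ≤ |ψ y - ψ x| := by
  have h1 := h.one_lt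
  rcases le_total x y with hxy | hxy
  · have := h.expand i x hx y hy hxy
    rw [abs_of_nonneg (sub_nonneg.2 hxy)]
    exact this.trans (le_abs_self _)
  · have := h.expand i y hy x hx hxy
    rw [abs_sub_comm, abs_sub_comm (ψ y), abs_of_nonneg (sub_nonneg.2 hxy)]
    exact this.trans (le_abs_self _)

theorem strictMonoOn (h : IsFullBranchSystem ψ lam p q a b) (i : ι) :
    StrictMonoOn ψ (Ioo (a i) (b i)) := by
  intro x hx y hy hxy
  have := h.expand i x hx y hy hxy.le
  have h1 := h.one_lt
  nlinarith

theorem index_unique (h : IsFullBranchSystem ψ lam p q a b) {i j : ι} {x : ℝ}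
    (hi : x ∈ Ioo (a i) (b i)) (hj : x ∈ Ioo (a j) (b j)) : i = j := by
  by_contra hij
  exact disjoint_left.1 (h.disjoint hij) hi hj

theorem le_or_le (h : IsFullBranchSystem ψ lam p q a b) {i j : ι} (hij : i ≠ j) :
    b i ≤ a j ∨ b j ≤ a i := by
  by_contra! hc
  have h1 := h.lt i
  have h2 := h.lt j
  have hlt : max (a i) (a j) < min (b i) (b j) := by
    simp [hc.1, hc.2, h1, h2]
  obtain ⟨x, hx1, hx2⟩ := exists_between hlt
  have hi : x ∈ Ioo (a i) (b i) :=
    ⟨(le_max_left _ _).trans_lt hx1, hx2.trans_le (min_le_left _ _)⟩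
  have hj : x ∈ Ioo (a j) (b j) :=
    ⟨(le_max_right _ _).trans_lt hx1, hx2.trans_le (min_le_right _ _)⟩
  exact hij (h.index_unique hi hj)

theorem limitSet_subset (h : IsFullBranchSystem ψ lam p q a b) : limitSet ψ a b ⊆ Ioo p q := by
  intro x hx
  obtain ⟨⟨i, hi⟩, -⟩ := mem_limitSet_iff.1 hx
  exact h.Ioo_subset i hi

theorem iterate_mem (hx : x ∈ limitSet ψ a b) (n : ℕ) : ψ^[n] x ∈ limitSet ψ a b := by
  intro m
  rw [← Function.iterate_add_apply]
  exact hx _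

theorem exists_fixed (h : IsFullBranchSystem ψ lam p q a b) (i : ι) :
    ∃ c ∈ Ioo (a i) (b i), ψ c = c := by
  obtain ⟨x, hx, hx'⟩ := h.surjOn i (h.left_mem i)
  obtain ⟨y, hy, hy'⟩ := h.surjOn i (h.right_mem i)
  have hxy : x ≤ y := by
    have := (h.strictMonoOn i).lt_iff_lt hx hy
    exact (this.1 (by rw [hx', hy']; exact h.lt i)).le
  have hsub : Icc x y ⊆ Ioo (a i) (b i) := Icc_subset_Ioo hx.1 hy.2
  have hc : ContinuousOn (fun t => ψ t - t) (Icc x y) :=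
    ((h.continuousOn i).mono hsub).sub continuousOn_id
  have := intermediate_value_Icc hxy hc
  obtain ⟨c, hc1, hc2⟩ := this (show (0 : ℝ) ∈ Icc _ _ from
    ⟨by simp only [hx']; linarith [hx.1], by simp only [hy']; linarith [hy.2]⟩)
  exact ⟨c, hsub hc1, by simp only at hc2; linarith⟩

/-- The minimum is the fixed point of the leftmost branch: a point of the limit set to its left
would be repelled leftwards within that branch and eventually pass `p`. -/
theorem exists_isLeast [Finite ι] [Nonempty ι] (h : IsFullBranchSystem ψ lam p q a b) :
    ∃ c, IsLeast (limitSet ψ a b) c ∧ ψ c = c := by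
  obtain ⟨i, hi⟩ := Finite.exists_min a
  obtain ⟨c, hc, hfix⟩ := h.exists_fixed i
  have hcK := mem_limitSet_of_fixed hc hfix
  refine ⟨c, ⟨hcK, fun x hx => ?_⟩, hfix⟩
  by_contra! hlt
  have h1 := h.one_lt
  have key : ∀ n, lam ^ n * (c - x) ≤ c - ψ^[n] x := by
    intro n
    induction n with
    | zero => simp
    | succ n ih =>
      have hy := iterate_mem hx n
      obtain ⟨⟨j, hj⟩, -⟩ := mem_limitSet_iff.1 hy
      have hyc : ψ^[n] x < c := by
        have : 0 < lam ^ n * (c - x) := by have := sub_pos.2 hlt; positivity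
        linarith
      have hij : j = i := by
        by_contra hij
        rcases h.le_or_le hij with h2 | h2
        · have := hi j
          have := h.lt j
          linarith
        · linarith [hj.1, hc.2]
      subst hij
      have := h.expand j _ hj c hc hyc.le
      rw [hfix] at this
      rw [Function.iterate_succ_apply', pow_succ']
      nlinarith
  obtain ⟨n, hn⟩ := pow_unbounded_of_one_lt ((c - p) / (c - x)) h1
  have h2 := sub_pos.2 hlt
  rw [div_lt_iff₀ h2] at hn
  have := key n
  have h3 := (h.limitSet_subset (iterate_mem hx n)).1
  linarith

theorem exists_isGreatest [Finite ι] [Nonempty ι] (h : IsFullBranchSystem ψ lam p q a b) :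
    ∃ d, IsGreatest (limitSet ψ a b) d ∧ ψ d = d := by
  obtain ⟨i, hi⟩ := Finite.exists_max b
  obtain ⟨c, hc, hfix⟩ := h.exists_fixed i
  have hcK := mem_limitSet_of_fixed hc hfix
  refine ⟨c, ⟨hcK, fun x hx => ?_⟩, hfix⟩
  by_contra! hlt
  have h1 := h.one_lt
  have key : ∀ n, lam ^ n * (x - c) ≤ ψ^[n] x - c := by
    intro n
    induction n with
    | zero => simp
    | succ n ih =>
      have hy := iterate_mem hx n
      obtain ⟨⟨j, hj⟩, -⟩ := mem_limitSet_iff.1 hy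
      have hyc : c < ψ^[n] x := by
        have : 0 < lam ^ n * (x - c) := by have := sub_pos.2 hlt; positivity
        linarith
      have hij : j = i := by
        by_contra hij
        rcases h.le_or_le hij with h2 | h2
        · linarith [hj.2, hc.1]
        · have := hi j
          have := h.lt j
          linarith
      subst hij
      have := h.expand j c hc _ hj hyc.le
      rw [hfix] at this
      rw [Function.iterate_succ_apply', pow_succ']
      nlinarith
  obtain ⟨n, hn⟩ := pow_unbounded_of_one_lt ((q - c) / (x - c)) h1
  have h2 := sub_pos.2 hlt
  rw [div_lt_iff₀ h2] at hn
  have := key n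
  have h3 := (h.limitSet_subset (iterate_mem hx n)).2
  linarith

/-- The convex hull of `limitSet` pulled back along the branches. -/
theorem exists_trimmed [Finite ι] [Nonempty ι] (h : IsFullBranchSystem ψ lam p q a b) :
    ∃ (c d : ℝ) (c' d' : ι → ℝ), IsLeast (limitSet ψ a b) c ∧ IsGreatest (limitSet ψ a b) d ∧
      ψ c = c ∧ ψ d = d ∧ ∀ i, c' i ∈ Ioo (a i) (b i) ∧ d' i ∈ Ioo (a i) (b i) ∧
        ψ (c' i) = c ∧ ψ (d' i) = d ∧ c' i ≤ d' i ∧ c' i ∈ limitSet ψ a b ∧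
        d' i ∈ limitSet ψ a b ∧
        ∀ x ∈ limitSet ψ a b, x ∈ Ioo (a i) (b i) → x ∈ Icc (c' i) (d' i) := by
  obtain ⟨c, hc, hcf⟩ := h.exists_isLeast
  obtain ⟨d, hd, hdf⟩ := h.exists_isGreatest
  have h1 : ∀ i, ∃ x ∈ Ioo (a i) (b i), ψ x = c := fun i =>
    h.surjOn i (h.limitSet_subset hc.1)
  have h2 : ∀ i, ∃ x ∈ Ioo (a i) (b i), ψ x = d := fun i =>
    h.surjOn i (h.limitSet_subset hd.1)
  choose c' hc' hc'' using h1
  choose d' hd' hd'' using h2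
  refine ⟨c, d, c', d', hc, hd, hcf, hdf, fun i => ⟨hc' i, hd' i, hc'' i, hd'' i, ?_, ?_, ?_, ?_⟩⟩
  · rw [← (h.strictMonoOn i).le_iff_le (hc' i) (hd' i), hc'' i, hd'' i]
    exact hc.2 hd.1
  · exact mem_limitSet_of_apply (hc' i) (by rw [hc'']; exact hc.1)
  · exact mem_limitSet_of_apply (hd' i) (by rw [hd'']; exact hd.1)
  · intro x hx hxi
    have hψ := (mem_limitSet_iff.1 hx).2
    constructor
    · rw [← (h.strictMonoOn i).le_iff_le (hc' i) hxi, hc'' i]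
      exact hc.2 hψ
    · rw [← (h.strictMonoOn i).le_iff_le hxi (hd' i), hd'' i]
      exact hd.2 hψ

theorem limitSet_eq_iInter {c' d' : ι → ℝ}
    (hV : ∀ i, Icc (c' i) (d' i) ⊆ Ioo (a i) (b i))
    (hK : ∀ i, ∀ x ∈ limitSet ψ a b, x ∈ Ioo (a i) (b i) → x ∈ Icc (c' i) (d' i)) :
    limitSet ψ a b = ⋂ n : ℕ, ψ^[n] ⁻¹' (⋃ i, Icc (c' i) (d' i)) := by
  ext x
  simp only [mem_iInter, mem_preimage]
  constructor
  · intro hx n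
    have hy := iterate_mem hx n
    obtain ⟨i, hi⟩ := (mem_limitSet_iff.1 hy).1
    exact mem_iUnion.2 ⟨i, hK i _ hy hi⟩
  · intro hx n
    obtain ⟨i, hi⟩ := mem_iUnion.1 (hx n)
    exact mem_iUnion.2 ⟨i, hV i hi⟩

/-- The intervals of the system are open, so closedness is read off the trimmed closed intervals,
which contain the whole limit set and on which `ψ` is continuous. -/
theorem isCompact_limitSet [Finite ι] [Nonempty ι] (h : IsFullBranchSystem ψ lam p q a b) :
    IsCompact (limitSet ψ a b) := by
  obtain ⟨c, d, c', d', hc, hd, -, -, H⟩ := h.exists_trimmed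
  have hV : ∀ i, Icc (c' i) (d' i) ⊆ Ioo (a i) (b i) := fun i =>
    Icc_subset_Ioo (H i).1.1 (H i).2.1.2
  have hE : IsCompact (⋃ i, Icc (c' i) (d' i)) := isCompact_iUnion fun i => isCompact_Icc
  have hcont : ContinuousOn ψ (⋃ i, Icc (c' i) (d' i)) := by
    intro x hx
    obtain ⟨i, hi⟩ := mem_iUnion.1 hx
    exact ((h.continuousOn i).continuousAt (isOpen_Ioo.mem_nhds (hV i hi))).continuousWithinAt
  have key : ∀ n : ℕ, IsClosed {x | ∀ m ≤ n, ψ^[m] x ∈ ⋃ i, Icc (c' i) (d' i)} := by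
    intro n
    induction n with
    | zero =>
      convert hE.isClosed using 1
      ext x
      simp
    | succ n ih =>
      have := hcont.preimage_isClosed_of_isClosed hE.isClosed ih
      convert this using 1
      ext x
      simp only [mem_ofPred_eq, mem_inter_iff, mem_preimage]
      constructor
      · intro hx
        refine ⟨hx 0 (Nat.zero_le _), fun m hm => ?_⟩
        rw [← Function.iterate_succ_apply]
        exact hx (m + 1) (by omega)
      · rintro ⟨h0, hx⟩ m hm
        cases m with
        | zero => exact h0
        | succ m =>
          rw [Function.iterate_succ_apply]
          exact hx m (by omega)
  have hEq := limitSet_eq_iInter hV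
    (fun i => (H i).2.2.2.2.2.2.2)
  refine hE.of_isClosed_subset ?_ ?_
  · have : limitSet ψ a b = ⋂ n : ℕ, {x | ∀ m ≤ n, ψ^[m] x ∈ ⋃ i, Icc (c' i) (d' i)} := by
      rw [hEq]
      ext x
      simp only [mem_iInter, mem_preimage, mem_ofPred_eq]
      exact ⟨fun hx n m _ => hx m, fun hx n => hx n n le_rfl⟩
    rw [this]
    exact isClosed_iInter key
  · rw [hEq]
    intro x hx
    exact mem_iInter.1 hx 0

/-- Points of the limit set with a prescribed `n`-th image are exponentially close to any
other point of the limit set. -/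
theorem exists_iterate_eq (h : IsFullBranchSystem ψ lam p q a b) (n : ℕ) :
    ∀ x ∈ limitSet ψ a b, ∀ z ∈ limitSet ψ a b, ∃ y ∈ limitSet ψ a b, ψ^[n] y = z ∧
      lam ^ n * |y - x| ≤ q - p := by
  induction n with
  | zero =>
    intro x hx z hz
    refine ⟨z, hz, rfl, ?_⟩
    have h1 := h.limitSet_subset hx
    have h2 := h.limitSet_subset hz
    rw [pow_zero, one_mul, abs_le]
    constructor <;> linarith [h1.1, h1.2, h2.1, h2.2]
  | succ n ih =>
    intro x hx z hz
    obtain ⟨⟨i, hi⟩, hψ⟩ := mem_limitSet_iff.1 hx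
    obtain ⟨y', hy', hy'z, hlen⟩ := ih _ hψ z hz
    obtain ⟨y, hy, rfl⟩ := h.surjOn i (h.limitSet_subset hy')
    refine ⟨y, mem_limitSet_of_apply hy hy', hy'z, ?_⟩
    have := h.expand_abs hi hy
    have h1 := h.one_lt
    calc lam ^ (n + 1) * |y - x| = lam ^ n * (lam * |y - x|) := by ring
      _ ≤ lam ^ n * |ψ y - ψ x| := by gcongr
      _ ≤ q - p := hlen

theorem isCantorSet_limitSet [Finite ι] [Nontrivial ι] (h : IsFullBranchSystem ψ lam p q a b) :
    IsCantorSet (limitSet ψ a b) := by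
  obtain ⟨c, d, c', d', hc, hd, -, -, H⟩ := h.exists_trimmed
  have h1 := h.one_lt
  have hcpt := h.isCompact_limitSet
  refine ⟨⟨c, hc.1⟩, hcpt, ⟨hcpt.isClosed, ?_⟩, ?_⟩
  · rw [preperfect_iff_nhds]
    intro x hx U hU
    obtain ⟨ε, hε, hεU⟩ := Metric.mem_nhds_iff.1 hU
    obtain ⟨n, hn⟩ := pow_unbounded_of_one_lt ((q - p) / ε) h1
    rw [div_lt_iff₀ hε] at hn
    -- A target different from the `n`-th image of `x` forces its preimage near `x` to differ from
    -- `x`; two branches provide two candidates.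
    obtain ⟨z, hz, hzx⟩ : ∃ z ∈ limitSet ψ a b, z ≠ ψ^[n] x := by
      obtain ⟨i, j, hij⟩ := exists_pair_ne ι
      by_cases hi : c' i = ψ^[n] x
      · refine ⟨c' j, (H j).2.2.2.2.2.1, fun hj => hij ?_⟩
        exact h.index_unique (H i).1 (by rw [hi, ← hj]; exact (H j).1)
      · exact ⟨c' i, (H i).2.2.2.2.2.1, hi⟩
    obtain ⟨y, hy, hyz, hlen⟩ := h.exists_iterate_eq n x hx z hz
    refine ⟨y, ⟨hεU ?_, hy⟩, ?_⟩
    · rw [Metric.mem_ball, Real.dist_eq]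
      have hp : 0 < lam ^ n := by positivity
      exact lt_of_mul_lt_mul_left (hlen.trans_lt hn) hp.le
    · rintro rfl
      exact hzx hyz.symm
  · intro t ht hpre
    -- An interval inside the limit set cannot leave a single branch, and its image is again such an
    -- interval, longer by the factor `lam`; this cannot go on inside `(p, q)`.
    have key : ∀ n, ∀ x y, x < y → Icc x y ⊆ limitSet ψ a b → lam ^ n * (y - x) ≤ q - p := by
      intro n
      induction n with
      | zero =>
        intro x y hxy hsub
        have h2 := h.limitSet_subset (hsub (left_mem_Icc.2 hxy.le))
        have h3 := h.limitSet_subset (hsub (right_mem_Icc.2 hxy.le))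
        rw [pow_zero, one_mul]
        linarith [h2.1, h3.2]
      | succ n ih =>
        intro x y hxy hsub
        obtain ⟨i, hi⟩ := (mem_limitSet_iff.1 (hsub (left_mem_Icc.2 hxy.le))).1
        have hy : y ∈ Ioo (a i) (b i) := by
          refine ⟨hi.1.trans hxy, ?_⟩
          by_contra! hb
          obtain ⟨j, hj⟩ := (mem_limitSet_iff.1 (hsub ⟨hi.2.le, hb⟩)).1
          have hij : i ≠ j := by
            rintro rfl
            exact lt_irrefl _ hj.2
          rcases h.le_or_le hij with h2 | h2
          · linarith [hj.1]
          · have := h.lt i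
            linarith [hj.2]
        have hVsub : Icc x y ⊆ Ioo (a i) (b i) := Icc_subset_Ioo hi.1 hy.2
        have himg : Icc (ψ x) (ψ y) ⊆ limitSet ψ a b := by
          intro z hz
          obtain ⟨w, hw, rfl⟩ :=
            intermediate_value_Icc hxy.le ((h.continuousOn i).mono hVsub) hz
          exact (mem_limitSet_iff.1 (hsub hw)).2
        have := ih _ _ (h.strictMonoOn i hi hy hxy) himg
        have h2 := h.expand i x hi y hy hxy.le
        calc lam ^ (n + 1) * (y - x) = lam ^ n * (lam * (y - x)) := by ring
          _ ≤ lam ^ n * (ψ y - ψ x) := by gcongr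
          _ ≤ q - p := this
    have key2 : ∀ x y, x < y → x ∈ t → y ∈ t → False := by
      intro x y hxy hx hy
      have hsub : Icc x y ⊆ limitSet ψ a b := (hpre.ordConnected.out hx hy).trans ht
      have hpos := sub_pos.2 hxy
      obtain ⟨n, hn⟩ := pow_unbounded_of_one_lt ((q - p) / (y - x)) h1
      rw [div_lt_iff₀ hpos] at hn
      linarith [key n x y hxy hsub]
    intro x hx y hy
    rcases lt_trichotomy x y with hxy | hxy | hxy
    · exact (key2 x y hxy hx hy).elim
    · exact hxy
    · exact (key2 y x hxy hy hx).elim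

/-- The Markov partition consists of the preimages, under each branch, of the convex hull `[c, d]`
of the limit set. As `[c, d]` lies inside `(p, q)`, these are compactly contained in the open
branches, hence disjoint even if the original closed intervals touch. -/
theorem isRegularCantorSetWith_limitSet {r : ℕ} [Nontrivial (Fin r)] {a b : Fin r → ℝ}
    (h : IsFullBranchSystem ψ lam p q a b) (hψ : ∀ i, ContDiffOn ℝ 2 ψ (Ioo (a i) (b i))) :
    ∃ c d : Fin r → ℝ, IsRegularCantorSetWith (limitSet ψ a b) c d ψ ∧
      ∀ i, Icc (c i) (d i) ⊆ Ioo (a i) (b i) := by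
  obtain ⟨c, d, c', d', hc, hd, hcf, hdf, H⟩ := h.exists_trimmed
  have h1 := h.one_lt
  have hV : ∀ i, Icc (c' i) (d' i) ⊆ Ioo (a i) (b i) := fun i =>
    Icc_subset_Ioo (H i).1.1 (H i).2.1.2
  have hK := fun i => (H i).2.2.2.2.2.2.2
  have hcd : c < d := by
    obtain ⟨i, j, hij⟩ := exists_pair_ne (Fin r)
    -- If `c = d`, the limit set is a point and would lie in two disjoint branches.
    refine lt_of_le_of_ne (hc.2 hd.1) fun heq => hij ?_
    have e1 : ∀ k, c' k = c := fun k =>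
      le_antisymm ((hd.2 (H k).2.2.2.2.2.1).trans heq.ge) (hc.2 (H k).2.2.2.2.2.1)
    have hi := (H i).1
    have hj := (H j).1
    rw [e1] at hi hj
    exact h.index_unique hi hj
  have hlt : ∀ i, c' i < d' i := fun i => by
    rw [← (h.strictMonoOn i).lt_iff_lt (H i).1 (H i).2.1, (H i).2.2.1, (H i).2.2.2.1]
    exact hcd
  have himage : ∀ i, ψ '' Icc (c' i) (d' i) = Icc c d := by
    intro i
    apply Subset.antisymm
    · rintro _ ⟨x, hx, rfl⟩
      have hm := (h.strictMonoOn i).monotoneOn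
      constructor
      · rw [← (H i).2.2.1]
        exact hm (H i).1 (hV i hx) hx.1
      · rw [← (H i).2.2.2.1]
        exact hm (hV i hx) (H i).2.1 hx.2
    · have := intermediate_value_Icc (hlt i).le ((h.continuousOn i).mono (hV i))
      rwa [(H i).2.2.1, (H i).2.2.2.1] at this
  have hdiff : ∀ i, DifferentiableOn ℝ ψ (Ioo (a i) (b i)) := fun i =>
    (hψ i).differentiableOn (by norm_num)
  have hsurjK : ∀ i, ψ '' (limitSet ψ a b ∩ Icc (c' i) (d' i)) = limitSet ψ a b := by
    intro i
    apply Subset.antisymm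
    · rintro _ ⟨x, hx, rfl⟩
      exact (mem_limitSet_iff.1 hx.1).2
    · intro y hy
      obtain ⟨x, hx, rfl⟩ := h.surjOn i (h.limitSet_subset hy)
      have hxK := mem_limitSet_of_apply hx hy
      exact ⟨x, ⟨hxK, hK i x hxK hx⟩, rfl⟩
  have hKK : ψ '' limitSet ψ a b = limitSet ψ a b := by
    obtain ⟨i, -, -⟩ := exists_pair_ne (Fin r)
    apply Subset.antisymm
    · rintro _ ⟨x, hx, rfl⟩
      exact (mem_limitSet_iff.1 hx).2
    · exact (hsurjK i).symm.subset.trans (image_mono inter_subset_left)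
  refine ⟨c', d', ⟨h.isCantorSet_limitSet, hlt, ?_, ?_, fun i => (H i).2.2.2.2.2.1,
    fun i => (H i).2.2.2.2.2.2.1, ?_, ?_, ?_, limitSet_eq_iInter hV hK⟩, hV⟩
  · intro i j hij
    exact (h.disjoint hij).mono (hV i) (hV j)
  · intro x hx
    obtain ⟨i, hi⟩ := (mem_limitSet_iff.1 hx).1
    exact mem_iUnion.2 ⟨i, hK i x hx hi⟩
  -- The neighbourhood stops halfway between the trimmed intervals and the ends of the branches, so
  -- that its closure is a compact set where `deriv ψ` is locally Lipschitz. This gives the Hölder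
  -- exponent `1`.
  · set u : Fin r → ℝ := fun i => (a i + c' i) / 2
    set v : Fin r → ℝ := fun i => (d' i + b i) / 2
    have hu : ∀ i, a i < u i ∧ u i < c' i := fun i =>
      ⟨by have := (H i).1.1; simp only [u]; linarith, by have := (H i).1.1; simp only [u]; linarith⟩
    have hv : ∀ i, d' i < v i ∧ v i < b i := fun i =>
      ⟨by have := (H i).2.1.2; simp only [v]; linarith,
        by have := (H i).2.1.2; simp only [v]; linarith⟩
    have hS : IsCompact (⋃ i, Icc (u i) (v i)) := isCompact_iUnion fun i => isCompact_Icc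
    have hsub : ∀ i, Icc (u i) (v i) ⊆ Ioo (a i) (b i) := fun i =>
      Icc_subset_Ioo (hu i).1 (hv i).2
    have hUS : (⋃ i, Ioo (u i) (v i)) ⊆ ⋃ i, Icc (u i) (v i) :=
      iUnion_mono fun i => Ioo_subset_Icc_self
    refine ⟨⋃ i, Ioo (u i) (v i), isOpen_iUnion fun i => isOpen_Ioo,
      iUnion_mono fun i => Icc_subset_Ioo (hu i).2 (hv i).1, ?_, ?_, lam, h1, ?_⟩
    · intro x hx
      obtain ⟨i, hi⟩ := mem_iUnion.1 hx
      exact ((hdiff i).differentiableAt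
        (isOpen_Ioo.mem_nhds (hsub i (Ioo_subset_Icc_self hi)))).differentiableWithinAt
    · have hloc : LocallyLipschitzOn (⋃ i, Icc (u i) (v i)) (deriv ψ) := by
        intro x hx
        obtain ⟨i, hi⟩ := mem_iUnion.1 hx
        have hx1 : ContDiffAt ℝ 1 (deriv ψ) x :=
          ((hψ i).deriv_of_isOpen isOpen_Ioo (by norm_num)).contDiffAt
            (isOpen_Ioo.mem_nhds (hsub i hi))
        obtain ⟨K, t, ht, hKt⟩ := hx1.exists_lipschitzOnWith
        exact ⟨K, t, mem_nhdsWithin_of_mem_nhds ht, hKt⟩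
      obtain ⟨C, hC⟩ := hloc.exists_lipschitzOnWith_of_compact hS
      refine ⟨C, 1, one_pos, le_rfl, ?_⟩
      rw [holderOnWith_one]
      exact hC.mono hUS
    · intro x hx
      obtain ⟨i, hi⟩ := mem_iUnion.1 hx
      have hxi := hsub i (Ioo_subset_Icc_self hi)
      have hd' := ((hdiff i).differentiableAt (isOpen_Ioo.mem_nhds hxi)).hasDerivAt
      refine le_trans ?_ (le_abs_self _)
      have ht := (hasDerivAt_iff_tendsto_slope.1 hd').mono_left
        (nhdsWithin_mono x (fun y (hy : y ∈ Ioi x) => ne_of_gt hy))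
      refine ge_of_tendsto ht ?_
      filter_upwards [self_mem_nhdsWithin,
        mem_nhdsWithin_of_mem_nhds (isOpen_Ioo.mem_nhds hxi)] with y hy hyi
      rw [slope_def_field, le_div_iff₀ (sub_pos.2 hy)]
      exact h.expand i x hxi y hyi (le_of_lt hy)
  · intro i
    refine ⟨Finset.univ, ?_⟩
    rw [himage i]
    apply Subset.antisymm
    · have hmem : ∀ x ∈ limitSet ψ a b, x ∈ ⋃ s ∈ (Finset.univ : Finset (Fin r)),
          Icc (c' s) (d' s) := by
        intro x hx
        obtain ⟨i, hi⟩ := (mem_limitSet_iff.1 hx).1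
        simp only [Finset.mem_univ, iUnion_true]
        exact mem_iUnion.2 ⟨i, hK i x hx hi⟩
      rw [← segment_eq_Icc hcd.le]
      exact segment_subset_convexHull (hmem c hc.1) (hmem d hd.1)
    · refine convexHull_min ?_ (convex_Icc c d)
      intro x hx
      simp only [Finset.mem_univ, iUnion_true] at hx
      obtain ⟨i, hi⟩ := mem_iUnion.1 hx
      exact ⟨(hc.2 (H i).2.2.2.2.2.1).trans hi.1, hi.2.trans (hd.2 (H i).2.2.2.2.2.2.1)⟩
  · intro i
    refine ⟨1, fun n hn => ?_⟩
    obtain ⟨m, rfl⟩ := Nat.exists_eq_add_of_le' hn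
    rw [Function.iterate_succ, image_comp, hsurjK i]
    clear hn
    induction m with
    | zero => simp
    | succ m ih => rw [Function.iterate_succ, image_comp, hKK, ih]

end IsFullBranchSystem

/-! ### A lower bound for the Hausdorff dimension -/

/-- The coordinate function of a self-similar subdivision of `[0, 1]`. -/
theorem exists_selfSimilar {X ι : Type*} (T : X → X) (idx : X → ι) (P w : ι → ℝ)
    (hP : ∀ i, 0 ≤ P i) (hw : ∀ i, 0 ≤ w i) (hPw : ∀ i, P i + w i ≤ 1) :
    ∃ h : X → ℝ, (∀ x, h x ∈ Icc (0 : ℝ) 1) ∧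
      ∀ x, h x = P (idx x) + w (idx x) * h (T x) := by
  -- Iterating the functional equation from `0` gives a monotone sequence bounded by `1`, whose
  -- limit solves the equation.
  let S : ℕ → X → ℝ := fun n => Nat.rec (fun _ => 0)
    (fun _ g x => P (idx x) + w (idx x) * g (T x)) n
  have hS : ∀ n x, S (n + 1) x = P (idx x) + w (idx x) * S n (T x) := fun n x => rfl
  have h01 : ∀ n x, S n x ∈ Icc (0 : ℝ) 1 := by
    intro n
    induction n with
    | zero => intro x; exact ⟨le_rfl, zero_le_one⟩
    | succ n ih =>
      intro x
      rw [hS]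
      have h1 := ih (T x)
      have h2 := hP (idx x)
      have h3 := hw (idx x)
      have h4 := hPw (idx x)
      constructor
      · have := mul_nonneg h3 h1.1
        linarith
      · have := mul_le_mul_of_nonneg_left h1.2 h3
        linarith
  have hmono : ∀ x, Monotone fun n => S n x := by
    intro x
    refine monotone_nat_of_le_succ fun n => ?_
    induction n generalizing x with
    | zero => exact (h01 1 x).1
    | succ n ih =>
      rw [hS n, hS (n + 1)]
      have := mul_le_mul_of_nonneg_left (ih (T x)) (hw (idx x))
      linarith
  have hlim : ∀ x, Tendsto (fun n => S n x) atTop (𝓝 (⨆ n, S n x)) := fun x =>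
    tendsto_atTop_ciSup (hmono x) ⟨1, by rintro _ ⟨n, rfl⟩; exact (h01 n x).2⟩
  refine ⟨fun x => ⨆ n, S n x, fun x => ?_, fun x => ?_⟩
  · exact isClosed_Icc.mem_of_tendsto (hlim x) (Eventually.of_forall fun n => h01 n x)
  · have h1 := (hlim x).comp (tendsto_add_atTop_nat 1)
    have h2 := ((hlim (T x)).const_mul (w (idx x))).const_add (P (idx x))
    exact tendsto_nhds_unique h1 h2

/-- A partition of `[0, 1]` into consecutive intervals of lengths `w i`. -/
theorem exists_subdivision {r : ℕ} (w : Fin r → ℝ) (hw : ∀ i, 0 ≤ w i) (hsum : ∑ i, w i = 1) :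
    ∃ P : Fin r → ℝ, (∀ i, 0 ≤ P i) ∧ (∀ i, P i + w i ≤ 1) ∧
      ∀ t ∈ Icc (0 : ℝ) 1, ∃ i, P i ≤ t ∧ t ≤ P i + w i := by
  let v : ℕ → ℝ := fun j => if h : j < r then w ⟨j, h⟩ else 0
  have hv : ∀ i : Fin r, v i = w i := fun i => by simp [v]
  have hv0 : ∀ j, 0 ≤ v j := fun j => by
    simp only [v]
    split_ifs
    · exact hw _
    · exact le_rfl
  have hr : ∑ j ∈ Finset.range r, v j = 1 := by
    rw [Finset.sum_range, ← hsum]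
    exact Finset.sum_congr rfl fun i _ => hv i
  refine ⟨fun i => ∑ j ∈ Finset.range i, v j, fun i => Finset.sum_nonneg fun j _ => hv0 j,
    fun i => ?_, fun t ht => ?_⟩
  · rw [← hv, ← Finset.sum_range_succ, ← hr]
    exact Finset.sum_le_sum_of_subset_of_nonneg
      (Finset.range_subset_range.2 i.2) fun j _ _ => hv0 j
  · by_contra! hc
    have key : ∀ k ≤ r, ∑ j ∈ Finset.range k, v j ≤ t ∧
        (0 < k → ∑ j ∈ Finset.range k, v j < t) := by
      intro k
      induction k with
      | zero => intro _; simpa using ht.1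
      | succ k ih =>
        intro hk
        have := hc ⟨k, hk⟩ (ih (by omega)).1
        rw [← hv, ← Finset.sum_range_succ] at this
        exact ⟨this.le, fun _ => this⟩
    rcases Nat.eq_zero_or_pos r with h0 | h0
    · subst h0
      simp at hsum
    · have := (key r le_rfl).2 h0
      rw [hr] at this
      exact absurd ht.2 (not_le.2 this)

theorem holderOnWith_of_abs_le {h : ℝ → ℝ} {K : Set ℝ} {C s : ℝ} (hC : 0 ≤ C) (hs : 0 ≤ s)
    (H : ∀ x ∈ K, ∀ y ∈ K, |h x - h y| ≤ C * |x - y| ^ s) :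
    HolderOnWith C.toNNReal s.toNNReal h K := by
  intro x hx y hy
  rw [edist_dist, edist_dist, Real.dist_eq, Real.dist_eq, Real.coe_toNNReal s hs,
    ENNReal.ofReal_rpow_of_nonneg (abs_nonneg _) hs]
  change _ ≤ ENNReal.ofReal C * _
  rw [← ENNReal.ofReal_mul hC]
  exact ENNReal.ofReal_le_ofReal (H x hx y hy)

/-- If `h` maps `K` onto `[0, 1]` and is Hölder with exponent `s`, then `K` has dimension at
least `s`. -/
theorem le_dimH_of_holder {h : ℝ → ℝ} {K : Set ℝ} {C s : ℝ} (hC : 0 ≤ C) (hs : 0 < s)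
    (H : ∀ x ∈ K, ∀ y ∈ K, |h x - h y| ≤ C * |x - y| ^ s) (hsurj : Icc (0 : ℝ) 1 ⊆ h '' K) :
    ENNReal.ofReal s ≤ dimH K := by
  have h1 := (holderOnWith_of_abs_le hC hs.le H).dimH_image_le (Real.toNNReal_pos.2 hs)
  have h2 : dimH (Icc (0 : ℝ) 1) = 1 := by
    rw [Real.dimH_of_nonempty_interior (by rw [interior_Icc]; exact nonempty_Ioo.2 one_pos)]
    simp
  have h3 := h2.symm.le.trans ((dimH_mono hsurj).trans h1)
  rw [ENNReal.le_div_iff_mul_le (Or.inl (by simpa using hs)) (Or.inl (by simp)), one_mul] at h3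
  exact h3

namespace IsFullBranchSystem

variable {ψ : ℝ → ℝ} {lam p q : ℝ}

/-- The limit set meets each branch only in its trimmed interval, which stays away from the ends of
the branch. -/
theorem exists_gap {ι : Type*} [Finite ι] [Nonempty ι] {a b : ι → ℝ}
    (h : IsFullBranchSystem ψ lam p q a b) :
    ∃ g > 0, ∀ i, ∀ x ∈ limitSet ψ a b, ∀ y, x ∈ Ioo (a i) (b i) → y ∉ Ioo (a i) (b i) →
      g ≤ |x - y| := by
  obtain ⟨c, d, c', d', hc, hd, -, -, H⟩ := h.exists_trimmed
  obtain ⟨i, hi⟩ := Finite.exists_min fun i => min (c' i - a i) (b i - d' i)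
  refine ⟨min (c' i - a i) (b i - d' i), ?_, ?_⟩
  · exact lt_min (sub_pos.2 (H i).1.1) (sub_pos.2 (H i).2.1.2)
  · intro j x hx y hxj hyj
    refine (hi j).trans ?_
    have hxI := (H j).2.2.2.2.2.2.2 x hx hxj
    by_cases hy : y ≤ a j
    · refine (min_le_left _ _).trans (le_trans ?_ (le_abs_self _))
      linarith [hxI.1]
    · have hy2 : b j ≤ y := by
        by_contra! hlt
        exact hyj ⟨not_le.1 hy, hlt⟩
      refine (min_le_right _ _).trans (le_trans ?_ (neg_le_abs _))
      linarith [hxI.2]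

/-- The coordinate `φ` is the analogue of a distribution function for the self-similar measure with
weights `w i`. Each application of a common branch multiplies differences of `φ` by `w i ≤ κ i ^ s`
and distances by at least `κ i`, so the Hölder constant never deteriorates; it is fixed by the gap
at the moment of separation. -/
theorem le_dimH_limitSet {r : ℕ} {a b : Fin r → ℝ} (h : IsFullBranchSystem ψ lam p q a b)
    (κ : Fin r → ℝ) (hκ : ∀ i, 0 < κ i)
    (hlip : ∀ i, ∀ x ∈ Ioo (a i) (b i), ∀ y ∈ Ioo (a i) (b i), x ≤ y →
      κ i * (ψ y - ψ x) ≤ y - x)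
    {s : ℝ} (hs : 0 < s) (hsum : 1 ≤ ∑ i, κ i ^ s) :
    ENNReal.ofReal s ≤ dimH (limitSet ψ a b) := by
  have h1 := h.one_lt
  have hne : Nonempty (Fin r) := by
    by_contra hemp
    rw [not_nonempty_iff] at hemp
    simp only [Finset.univ_eq_empty, Finset.sum_empty] at hsum
    linarith
  set Z := ∑ i, κ i ^ s with hZ
  have hZ0 : 0 < Z := by linarith
  set w : Fin r → ℝ := fun i => κ i ^ s / Z with hw
  have hw0 : ∀ i, 0 < w i := fun i => div_pos (Real.rpow_pos_of_pos (hκ i) s) hZ0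
  have hwκ : ∀ i, w i ≤ κ i ^ s := fun i =>
    div_le_self (Real.rpow_pos_of_pos (hκ i) s).le hsum
  -- The expansion bound and the Lipschitz bound are compared on one pair of points of the branch.
  have hκlam : ∀ i, κ i ≤ lam⁻¹ := by
    intro i
    obtain ⟨x, hx1, hx2⟩ := exists_between (h.lt i)
    obtain ⟨y, hy1, hy2⟩ := exists_between hx2
    have hx : x ∈ Ioo (a i) (b i) := ⟨hx1, hx2⟩
    have hy : y ∈ Ioo (a i) (b i) := ⟨hx1.trans hy1, hy2⟩
    have e1 := hlip i x hx y hy hy1.le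
    have e2 := h.expand i x hx y hy hy1.le
    have e3 := sub_pos.2 hy1
    have hk := hκ i
    rw [le_inv_comm₀ hk (by linarith), ← one_div, le_div_iff₀ hk]
    have e4 := mul_le_mul_of_nonneg_left e2 hk.le
    have e5 : (lam * κ i) * (y - x) ≤ 1 * (y - x) := by nlinarith
    exact le_of_mul_le_mul_right e5 e3
  set ρ : ℝ := lam⁻¹ ^ s with hρ
  have hlam0 : 0 < lam⁻¹ := by positivity
  have hρ0 : 0 < ρ := Real.rpow_pos_of_pos hlam0 s
  have hρ1 : ρ < 1 := Real.rpow_lt_one hlam0.le (inv_lt_one_of_one_lt₀ h1) hs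
  have hwρ : ∀ i, w i ≤ ρ := fun i =>
    (hwκ i).trans (Real.rpow_le_rpow (hκ i).le (hκlam i) hs.le)
  have hwsum : ∑ i, w i = 1 := by
    rw [hw, ← Finset.sum_div, ← hZ, div_self hZ0.ne']
  obtain ⟨P, hP0, hP1, hPt⟩ := exists_subdivision w (fun i => (hw0 i).le) hwsum
  -- Off the limit set the branch index is arbitrary and plays no role.
  have hidx : ∀ x, ∃ i, x ∈ limitSet ψ a b → x ∈ Ioo (a i) (b i) := by
    intro x
    by_cases hx : x ∈ limitSet ψ a b
    · obtain ⟨i, hi⟩ := (mem_limitSet_iff.1 hx).1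
      exact ⟨i, fun _ => hi⟩
    · exact ⟨hne.some, fun h => absurd h hx⟩
  choose idx hidx using hidx
  obtain ⟨φ, hφ01, hφ⟩ := exists_selfSimilar ψ idx P w hP0 (fun i => (hw0 i).le) hP1
  obtain ⟨g, hg, hgap⟩ := h.exists_gap
  have hgs : 0 < g ^ s := Real.rpow_pos_of_pos hg s
  have hφdist : ∀ x y, |φ x - φ y| ≤ 1 := fun x y => by
    have e1 := hφ01 x
    have e2 := hφ01 y
    rw [abs_le]
    constructor <;> linarith [e1.1, e1.2, e2.1, e2.2]
  -- The hypothesis on `n` forces the two orbits to visit different branches before time `n`.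
  have key : ∀ n : ℕ, ∀ x ∈ limitSet ψ a b, ∀ y ∈ limitSet ψ a b, q - p < lam ^ n * |x - y| →
      |φ x - φ y| ≤ (g ^ s)⁻¹ * |x - y| ^ s := by
    intro n
    induction n with
    | zero =>
      intro x hx y hy hlt
      have e1 := h.limitSet_subset hx
      have e2 := h.limitSet_subset hy
      rw [pow_zero, one_mul, lt_abs] at hlt
      rcases hlt with hlt | hlt <;> linarith [e1.1, e1.2, e2.1, e2.2]
    | succ n ih =>
      intro x hx y hy hlt
      have hxi := hidx x hx
      by_cases hyi : y ∈ Ioo (a (idx x)) (b (idx x))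
      · have hij : idx y = idx x := h.index_unique (hidx y hy) hyi
        have hx' := (mem_limitSet_iff.1 hx).2
        have hy' := (mem_limitSet_iff.1 hy).2
        have e1 := h.expand_abs hyi hxi
        have e2 : q - p < lam ^ n * |ψ x - ψ y| := by
          refine hlt.trans_le ?_
          rw [pow_succ, mul_assoc]
          gcongr
        have e3 := ih _ hx' _ hy' e2
        have e4 : κ (idx x) * |ψ x - ψ y| ≤ |x - y| := by
          rcases le_total x y with hxy | hxy
          · have := hlip _ x hxi y hyi hxy
            have hm := (h.strictMonoOn _).monotoneOn hxi hyi hxy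
            rw [abs_sub_comm, abs_sub_comm x, abs_of_nonneg (sub_nonneg.2 hm),
              abs_of_nonneg (sub_nonneg.2 hxy)]
            exact this
          · have := hlip _ y hyi x hxi hxy
            have hm := (h.strictMonoOn _).monotoneOn hyi hxi hxy
            rw [abs_of_nonneg (sub_nonneg.2 hm), abs_of_nonneg (sub_nonneg.2 hxy)]
            exact this
        rw [hφ x, hφ y, hij]
        have e5 : P (idx x) + w (idx x) * φ (ψ x) - (P (idx x) + w (idx x) * φ (ψ y)) =
            w (idx x) * (φ (ψ x) - φ (ψ y)) := by ring
        rw [e5, abs_mul, abs_of_pos (hw0 _)]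
        calc w (idx x) * |φ (ψ x) - φ (ψ y)|
            ≤ κ (idx x) ^ s * ((g ^ s)⁻¹ * |ψ x - ψ y| ^ s) := by
              have := (Real.rpow_pos_of_pos (hκ (idx x)) s).le
              gcongr
              exact hwκ _
          _ = (g ^ s)⁻¹ * (κ (idx x) * |ψ x - ψ y|) ^ s := by
              rw [Real.mul_rpow (hκ _).le (abs_nonneg _)]
              ring
          _ ≤ (g ^ s)⁻¹ * |x - y| ^ s := by
              have := (hκ (idx x)).le
              gcongr
      · have e1 := hgap _ x hx y hxi hyi
        refine (hφdist x y).trans ?_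
        rw [inv_mul_eq_div, le_div_iff₀ hgs, one_mul]
        gcongr
  have holder : ∀ x ∈ limitSet ψ a b, ∀ y ∈ limitSet ψ a b,
      |φ x - φ y| ≤ (g ^ s)⁻¹ * |x - y| ^ s := by
    intro x hx y hy
    by_cases hxy : x = y
    · subst hxy
      simp only [sub_self, abs_zero]
      positivity
    · have hpos : 0 < |x - y| := abs_pos.2 (sub_ne_zero.2 hxy)
      obtain ⟨n, hn⟩ := pow_unbounded_of_one_lt ((q - p) / |x - y|) h1
      rw [div_lt_iff₀ hpos] at hn
      exact key n x hx y hy hn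
  -- Surjectivity of `φ` follows from density of its image, which is compact.
  have hdense : ∀ n : ℕ, ∀ t ∈ Icc (0 : ℝ) 1, ∃ x ∈ limitSet ψ a b, |φ x - t| ≤ ρ ^ n := by
    intro n
    induction n with
    | zero =>
      intro t ht
      obtain ⟨c, hc, -⟩ := h.exists_isLeast
      refine ⟨c, hc.1, ?_⟩
      have e1 := hφ01 c
      rw [pow_zero, abs_le]
      constructor <;> linarith [e1.1, e1.2, ht.1, ht.2]
    | succ n ih =>
      intro t ht
      obtain ⟨i, hi1, hi2⟩ := hPt t ht
      have hwi := hw0 i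
      obtain ⟨y, hy, hyt⟩ := ih ((t - P i) / w i)
        ⟨div_nonneg (sub_nonneg.2 hi1) hwi.le, by rw [div_le_one hwi]; linarith⟩
      obtain ⟨x, hx, rfl⟩ := h.surjOn i (h.limitSet_subset hy)
      have hxK := mem_limitSet_of_apply hx hy
      have hix : idx x = i := h.index_unique (hidx x hxK) hx
      refine ⟨x, hxK, ?_⟩
      rw [hφ x, hix]
      have e1 : P i + w i * φ (ψ x) - t = w i * (φ (ψ x) - (t - P i) / w i) := by
        field_simp
        ring
      rw [e1, abs_mul, abs_of_pos hwi, pow_succ']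
      exact mul_le_mul (hwρ i) hyt (abs_nonneg _) hρ0.le
  refine le_dimH_of_holder (inv_pos.2 hgs).le hs holder ?_
  have hcont : ContinuousOn φ (limitSet ψ a b) :=
    (holderOnWith_of_abs_le (inv_pos.2 hgs).le hs.le holder).continuousOn
      (Real.toNNReal_pos.2 hs)
  have hclosed : IsClosed (φ '' limitSet ψ a b) := (h.isCompact_limitSet.image_of_continuousOn
    hcont).isClosed
  intro t ht
  rw [← hclosed.closure_eq, Metric.mem_closure_iff]
  intro ε hε
  obtain ⟨n, hn⟩ := exists_pow_lt_of_lt_one hε hρ1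
  obtain ⟨x, hx, hxt⟩ := hdense n t ht
  refine ⟨φ x, ⟨x, hx, rfl⟩, ?_⟩
  rw [dist_comm, Real.dist_eq]
  exact hxt.trans_lt hn

end IsFullBranchSystem

/-! ### Estimates for Lorenz maps -/

/-- The interior of `dom`. -/
def domInt : Set ℝ := Ioo (-1 / 2) (1 / 2) \ {0}

theorem isOpen_domInt : IsOpen domInt := isOpen_Ioo.sdiff isClosed_singleton

theorem domInt_subset_dom : domInt ⊆ dom := fun _ hx => ⟨Ioo_subset_Icc_self hx.1, hx.2⟩

theorem dom_mem_nhds {x : ℝ} (hx : x ∈ domInt) : dom ∈ 𝓝 x :=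
  mem_of_superset (isOpen_domInt.mem_nhds hx) domInt_subset_dom

/-- The quantitative properties of Lorenz maps, on the open domain `domInt`, that are used to
construct horseshoes. -/
structure LorenzBounds (f : ℝ → ℝ) (α lam M ρ : ℝ) : Prop where
  alpha_pos : 0 < α
  alpha_lt_one : α < 1
  two_lt_sq : 2 < lam ^ 2
  le_lam : 7 / 5 ≤ lam
  lam_le_two : lam ≤ 2
  contDiffAt : ∀ x ∈ domInt, ContDiffAt ℝ 2 f x
  lam_le : ∀ x ∈ domInt, lam ≤ deriv f x
  mapsTo : MapsTo f domInt (Ioo (-1 / 2) (1 / 2))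
  M_pos : 0 < M
  abs_deriv2_le : ∀ x ∈ domInt, |deriv (deriv f) x| ≤ M * |x| ^ (-α) * deriv f x ^ 2
  rho_pos : 0 < ρ
  four_le : ∀ x ∈ domInt, |x| ≤ ρ → 4 ≤ deriv f x
  lim_left : Tendsto f (𝓝[<] 0) (𝓝 (1 / 2))
  lim_right : Tendsto f (𝓝[>] 0) (𝓝 (-1 / 2))

theorem uniqueDiffOn_dom : UniqueDiffOn ℝ dom := by
  have : dom = Icc (-1 / 2 : ℝ) (1 / 2) ∩ {0}ᶜ := sdiff_eq
  rw [this]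
  exact (uniqueDiffOn_Icc (by norm_num)).inter isOpen_compl_singleton

theorem mul_sub_le_of_le_deriv {f : ℝ → ℝ} {S : Set ℝ} (hf : ∀ x ∈ S, DifferentiableAt ℝ f x)
    {m : ℝ} (hm : ∀ x ∈ S, m ≤ deriv f x) {x y : ℝ} (hxy : x ≤ y) (hS : Icc x y ⊆ S) :
    m * (y - x) ≤ f y - f x := by
  refine Convex.mul_sub_le_image_sub_of_le_deriv (convex_Icc x y)
    (fun z hz => (hf z (hS hz)).continuousAt.continuousWithinAt)
    (fun z hz => (hf z (hS (interior_subset hz))).differentiableWithinAt)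
    (fun z hz => hm z (hS (interior_subset hz)))
    x (left_mem_Icc.2 hxy) y (right_mem_Icc.2 hxy) hxy

theorem Icc_subset_domInt {x y : ℝ} (hx : -1 / 2 < x) (hy : y < 1 / 2) (h : 0 < x ∨ y < 0) :
    Icc x y ⊆ domInt := by
  intro z hz
  refine ⟨⟨hx.trans_le hz.1, hz.2.trans_lt hy⟩, ?_⟩
  rintro rfl
  rcases h with h | h
  · exact absurd hz.1 (not_le.2 h)
  · exact absurd hz.2 (not_le.2 h)

/-- The pointwise bound `f' > √2` becomes uniform because `f'` is large near `0` and attains a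
minimum on the compact remainder. The distortion bound comes from `|x| ^ (α - 2) = |x| ^ (-α) * (|x|
^ (α - 1)) ^ 2` and `|x| ^ (α - 1) ≤ C * f'`. -/
theorem IsLorenzMap.exists_bounds {f : ℝ → ℝ} {α : ℝ} (hf : IsLorenzMap f α) :
    ∃ lam M ρ, LorenzBounds f α lam M ρ := by
  have hd : ∀ x ∈ domInt, derivWithin f dom x = deriv f x := fun x hx =>
    derivWithin_of_mem_nhds (dom_mem_nhds hx)
  have hdd : ∀ x ∈ domInt, derivWithin (derivWithin f dom) dom x = deriv (deriv f) x := by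
    intro x hx
    rw [derivWithin_of_mem_nhds (dom_mem_nhds hx)]
    apply Filter.EventuallyEq.deriv_eq
    filter_upwards [isOpen_domInt.mem_nhds hx] with y hy using hd y hy
  have hC2 : ∀ x ∈ domInt, ContDiffAt ℝ 2 f x := fun x hx =>
    hf.contDiffOn.contDiffAt (dom_mem_nhds hx)
  have hdiff : ∀ x ∈ domInt, DifferentiableAt ℝ f x := fun x hx =>
    (hC2 x hx).differentiableAt (by norm_num)
  obtain ⟨ρ, hρ, hρ4⟩ : ∃ ρ > 0, ∀ x ∈ dom, |x| < ρ → 4 ≤ derivWithin f dom x := by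
    have h1 := hf.deriv_lim_left.eventually_ge_atTop 4
    have h2 := hf.deriv_lim_right.eventually_ge_atTop 4
    have h3 := h1.filter_mono (le_refl (𝓝[<] (0 : ℝ)))
    rw [eventually_nhdsWithin_iff, Metric.eventually_nhds_iff] at h2 h3
    obtain ⟨e1, he1, h1⟩ := h3
    obtain ⟨e2, he2, h2⟩ := h2
    refine ⟨min e1 e2, lt_min he1 he2, fun x hx hxr => ?_⟩
    rcases lt_or_gt_of_ne hx.2 with h0 | h0
    · exact h1 (by rw [Real.dist_eq, sub_zero]; exact hxr.trans_le (min_le_left _ _)) h0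
    · exact h2 (by rw [Real.dist_eq, sub_zero]; exact hxr.trans_le (min_le_right _ _)) h0
  obtain ⟨m, hm, hm'⟩ : ∃ m, √2 < m ∧ ∀ x ∈ dom, ρ ≤ |x| → m ≤ derivWithin f dom x := by
    have hT : IsCompact (Icc (-1 / 2 : ℝ) (1 / 2) ∩ {x | ρ ≤ |x|}) :=
      isCompact_Icc.inter_right (isClosed_le continuous_const continuous_abs)
    have hTd : Icc (-1 / 2 : ℝ) (1 / 2) ∩ {x | ρ ≤ |x|} ⊆ dom := by
      rintro x ⟨hx, hxr⟩
      refine ⟨hx, ?_⟩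
      rintro rfl
      simp only [mem_ofPred_eq, abs_zero] at hxr
      linarith
    rcases (Icc (-1 / 2 : ℝ) (1 / 2) ∩ {x | ρ ≤ |x|}).eq_empty_or_nonempty with he | hne
    · refine ⟨√2 + 1, by linarith, fun x hx hxr => ?_⟩
      have : x ∈ Icc (-1 / 2 : ℝ) (1 / 2) ∩ {x | ρ ≤ |x|} := ⟨hx.1, hxr⟩
      rw [he] at this
      exact this.elim
    · obtain ⟨z, hz, hmin⟩ := hT.exists_isMinOn hne
        ((hf.contDiffOn.continuousOn_derivWithin uniqueDiffOn_dom (by norm_num)).mono hTd)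
      exact ⟨_, hf.sqrt_two_lt_deriv z (hTd hz), fun x hx hxr => hmin ⟨hx.1, hxr⟩⟩
  obtain ⟨C, hC1, hC⟩ := hf.deriv_bounds
  obtain ⟨C₁, hC₁1, hC₁⟩ := hf.deriv2_bound
  have hlam : √2 < min m 2 := by
    refine lt_min hm ?_
    rw [Real.sqrt_lt' (by norm_num)]
    norm_num
  have hlam2 : 2 < min m 2 ^ 2 := by
    have := Real.sq_sqrt (show (0 : ℝ) ≤ 2 by norm_num)
    have h0 := Real.sqrt_nonneg 2
    nlinarith
  have hle : ∀ x ∈ domInt, min m 2 ≤ deriv f x := by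
    intro x hx
    rw [← hd x hx]
    rcases lt_or_ge |x| ρ with h | h
    · have := hρ4 x (domInt_subset_dom hx) h
      exact (min_le_right _ _).trans (by linarith)
    · exact (min_le_left _ _).trans (hm' x (domInt_subset_dom hx) h)
  have hlam0 : 0 < min m 2 := (Real.sqrt_nonneg 2).trans_lt hlam
  have hmono : ∀ x y, x < y → Icc x y ⊆ domInt → f x < f y := by
    intro x y hxy hsub
    have := mul_sub_le_of_le_deriv hdiff hle hxy.le hsub
    have h2 := mul_pos hlam0 (sub_pos.2 hxy)
    linarith
  -- The cap at `2` is harmless and keeps `(lam ^ 2 + 2) / 4 ≤ lam`, used when intervals are made to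
  -- grow. The radius is halved to pass from `|x| < ρ` to a closed condition.
  refine ⟨min m 2, C₁ * C ^ 2, ρ / 2, hf.alpha_pos, hf.alpha_lt_one, hlam2, by nlinarith,
    min_le_right _ _, hC2, hle, ?_, by positivity, ?_, by positivity, ?_, hf.lim_left,
    hf.lim_right⟩
  · intro x hx
    obtain ⟨y, z, hyx, hxz, hsub⟩ : ∃ y z, y < x ∧ x < z ∧ Icc y z ⊆ domInt := by
      rcases lt_or_gt_of_ne hx.2 with h0 | h0
      · exact ⟨(-1 / 2 + x) / 2, x / 2, by linarith [hx.1.1], by linarith,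
          Icc_subset_domInt (by linarith [hx.1.1]) (by linarith) (Or.inr (by linarith))⟩
      · exact ⟨x / 2, (1 / 2 + x) / 2, by linarith, by linarith [hx.1.2],
          Icc_subset_domInt (by linarith) (by linarith [hx.1.2]) (Or.inl (by linarith))⟩
    have e1 := hmono y x hyx ((Icc_subset_Icc le_rfl hxz.le).trans hsub)
    have e2 := hmono x z hxz ((Icc_subset_Icc hyx.le le_rfl).trans hsub)
    have e3 := hf.mapsTo (domInt_subset_dom (hsub ⟨le_rfl, (hyx.trans hxz).le⟩))
    have e4 := hf.mapsTo (domInt_subset_dom (hsub ⟨(hyx.trans hxz).le, le_rfl⟩))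
    exact ⟨e3.1.trans_lt e1, e2.trans_le e4.2⟩
  · intro x hx
    have hx0 : 0 < |x| := abs_pos.2 hx.2
    have e1 := (hC x (domInt_subset_dom hx)).1
    have e2 := hC₁ x (domInt_subset_dom hx)
    rw [hd x hx] at e1
    rw [hdd x hx] at e2
    rw [le_div_iff₀ (Real.rpow_pos_of_pos hx0 _)] at e1
    rw [div_le_iff₀ (Real.rpow_pos_of_pos hx0 _)] at e2
    have hp : |x| ^ (α - 2) = |x| ^ (-α) * (|x| ^ (α - 1)) ^ 2 := by
      rw [← Real.rpow_natCast, ← Real.rpow_mul hx0.le, ← Real.rpow_add hx0]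
      congr 1
      push_cast
      ring
    have hA : |x| ^ (α - 1) ≤ C * deriv f x := by
      have hC0 : 0 < C := by linarith
      rw [one_div, inv_mul_eq_div, div_le_iff₀ hC0] at e1
      linarith
    have hB : 0 ≤ |x| ^ (α - 1) := (Real.rpow_pos_of_pos hx0 _).le
    calc |deriv (deriv f) x| ≤ C₁ * (|x| ^ (-α) * (|x| ^ (α - 1)) ^ 2) := by rw [← hp]; exact e2
      _ ≤ C₁ * (|x| ^ (-α) * (C * deriv f x) ^ 2) := by gcongr
      _ = C₁ * C ^ 2 * |x| ^ (-α) * deriv f x ^ 2 := by ring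
  · intro x hx hxr
    rw [← hd x hx]
    exact hρ4 x (domInt_subset_dom hx) (by linarith)

/-! ### Iterates along orbit segments that avoid the singularity -/

/-- The points whose first `n` iterates stay in `domInt`, at distance at least `δ` from `0`. -/
def survivors (f : ℝ → ℝ) (δ : ℝ) (n : ℕ) : Set ℝ :=
  {x | x ∈ Ioo (-1 / 2 : ℝ) (1 / 2) ∧ ∀ i < n, f^[i] x ∈ domInt ∧ δ ≤ |f^[i] x|}

theorem survivors_succ {f : ℝ → ℝ} {δ : ℝ} {n : ℕ} {x : ℝ} :
    x ∈ survivors f δ (n + 1) ↔ x ∈ survivors f δ n ∧ f^[n] x ∈ domInt ∧ δ ≤ |f^[n] x| := by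
  simp only [survivors, mem_ofPred_eq, Nat.forall_lt_succ_right, and_assoc]

theorem survivors_mono {f : ℝ → ℝ} {δ δ' : ℝ} (h : δ ≤ δ') {n m : ℕ} (hnm : n ≤ m) :
    survivors f δ' m ⊆ survivors f δ n :=
  fun _ hx => ⟨hx.1, fun i hi => ⟨(hx.2 i (hi.trans_le hnm)).1,
    h.trans (hx.2 i (hi.trans_le hnm)).2⟩⟩

theorem mem_survivors_add {f : ℝ → ℝ} {n m : ℕ} {x : ℝ} :
    x ∈ survivors f 0 n → f^[n] x ∈ survivors f 0 m → x ∈ survivors f 0 (n + m) := by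
  intro hx hy
  refine ⟨hx.1, fun i hi => ⟨?_, abs_nonneg _⟩⟩
  rcases lt_or_ge i n with h | h
  · exact (hx.2 i h).1
  · obtain ⟨j, rfl⟩ := Nat.exists_eq_add_of_le' h
    rw [Function.iterate_add_apply]
    exact (hy.2 j (by omega)).1

namespace LorenzBounds

variable {f : ℝ → ℝ} {α lam M ρ : ℝ}

theorem one_lt_lam (h : LorenzBounds f α lam M ρ) : 1 < lam := by linarith [h.le_lam]

theorem differentiableAt (h : LorenzBounds f α lam M ρ) {x : ℝ} (hx : x ∈ domInt) :
    DifferentiableAt ℝ f x :=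
  (h.contDiffAt x hx).differentiableAt (by norm_num)

theorem expand (h : LorenzBounds f α lam M ρ) {x y : ℝ} (hxy : x ≤ y) (hS : Icc x y ⊆ domInt) :
    lam * (y - x) ≤ f y - f x :=
  mul_sub_le_of_le_deriv (fun _ hx => h.differentiableAt hx) h.lam_le hxy hS

theorem iterate_mem (h : LorenzBounds f α lam M ρ) {δ : ℝ} {n : ℕ} {x : ℝ}
    (hx : x ∈ survivors f δ n) : f^[n] x ∈ Ioo (-1 / 2 : ℝ) (1 / 2) := by
  cases n with
  | zero => exact hx.1
  | succ n =>
    rw [Function.iterate_succ_apply']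
    exact h.mapsTo (hx.2 n (Nat.lt_succ_self n)).1

theorem contDiffAt_iterate (h : LorenzBounds f α lam M ρ) {δ : ℝ} {n : ℕ} :
    ∀ {x : ℝ}, x ∈ survivors f δ n → ContDiffAt ℝ 2 f^[n] x := by
  induction n with
  | zero => intro x _; exact contDiffAt_id
  | succ n ih =>
    intro x hx
    rw [survivors_succ] at hx
    rw [Function.iterate_succ']
    exact (h.contDiffAt _ hx.2.1).comp x (ih hx.1)

theorem differentiableAt_iterate (h : LorenzBounds f α lam M ρ) {δ : ℝ} {n : ℕ} {x : ℝ}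
    (hx : x ∈ survivors f δ n) : DifferentiableAt ℝ f^[n] x :=
  (h.contDiffAt_iterate hx).differentiableAt (by norm_num)

theorem continuousOn_iterate (h : LorenzBounds f α lam M ρ) {δ : ℝ} {n : ℕ} {S : Set ℝ}
    (hS : S ⊆ survivors f δ n) : ContinuousOn f^[n] S := fun _ hx =>
  (h.differentiableAt_iterate (hS hx)).continuousAt.continuousWithinAt

theorem deriv_iterate_succ (h : LorenzBounds f α lam M ρ) {δ : ℝ} {n : ℕ} {x : ℝ}
    (hx : x ∈ survivors f δ (n + 1)) :
    deriv f^[n + 1] x = deriv f (f^[n] x) * deriv f^[n] x := by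
  rw [survivors_succ] at hx
  rw [Function.iterate_succ', deriv_comp x (h.differentiableAt hx.2.1)
    (h.differentiableAt_iterate hx.1)]

theorem pow_le_deriv_iterate (h : LorenzBounds f α lam M ρ) {δ : ℝ} {n : ℕ} :
    ∀ {x : ℝ}, x ∈ survivors f δ n → lam ^ n ≤ deriv f^[n] x := by
  have h1 := h.one_lt_lam
  induction n with
  | zero => intro x _; simp
  | succ n ih =>
    intro x hx
    rw [h.deriv_iterate_succ hx, pow_succ']
    rw [survivors_succ] at hx
    have e1 := ih hx.1
    have e2 := h.lam_le _ hx.2.1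
    have e3 : 0 < lam ^ n := by positivity
    exact mul_le_mul e2 e1 e3.le (by linarith)

theorem pow_expand (h : LorenzBounds f α lam M ρ) {δ : ℝ} {n : ℕ} {x y : ℝ} (hxy : x ≤ y)
    (hS : Icc x y ⊆ survivors f δ n) : lam ^ n * (y - x) ≤ f^[n] y - f^[n] x :=
  mul_sub_le_of_le_deriv (fun _ hx => h.differentiableAt_iterate hx)
    (fun _ hx => h.pow_le_deriv_iterate hx) hxy hS

theorem strictMonoOn_iterate (h : LorenzBounds f α lam M ρ) {δ : ℝ} {n : ℕ} {a b : ℝ}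
    (hS : Icc a b ⊆ survivors f δ n) : StrictMonoOn f^[n] (Icc a b) := by
  intro x hx y hy hxy
  have := h.pow_expand hxy.le ((Icc_subset_Icc hx.1 hy.2).trans hS)
  have h2 := h.one_lt_lam
  have h1 : 0 < lam ^ n * (y - x) := by have := sub_pos.2 hxy; positivity
  linarith

/-- Pulling back a subinterval of the image of a branch. -/
theorem exists_pullback (h : LorenzBounds f α lam M ρ) {δ : ℝ} {n : ℕ} {a b c d : ℝ}
    (hab : a ≤ b) (hS : Icc a b ⊆ survivors f δ n) (hac : f^[n] a ≤ c) (hcd : c < d)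
    (hdb : d ≤ f^[n] b) :
    ∃ a' b', a ≤ a' ∧ a' < b' ∧ b' ≤ b ∧ f^[n] a' = c ∧ f^[n] b' = d := by
  have hiv := intermediate_value_Icc hab (h.continuousOn_iterate hS)
  obtain ⟨a', ha', rfl⟩ := hiv ⟨hac, (hcd.trans_le hdb).le⟩
  obtain ⟨b', hb', rfl⟩ := hiv ⟨(hac.trans_lt hcd).le, hdb⟩
  exact ⟨a', b', ha'.1, ((h.strictMonoOn_iterate hS).lt_iff_lt ha' hb').1 hcd, hb'.2, rfl, rfl⟩

theorem image_subset (h : LorenzBounds f α lam M ρ) {δ : ℝ} {n : ℕ} {a b x : ℝ}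
    (hS : Icc a b ⊆ survivors f δ n) (hx : x ∈ Icc a b) :
    f^[n] x ∈ Icc (f^[n] a) (f^[n] b) := by
  have hm := (h.strictMonoOn_iterate hS).monotoneOn
  have hab := hx.1.trans hx.2
  exact ⟨hm (left_mem_Icc.2 hab) hx hx.1, hm hx (right_mem_Icc.2 hab) hx.2⟩

theorem surjOn (h : LorenzBounds f α lam M ρ) {δ : ℝ} {n : ℕ} {a b : ℝ} (hab : a ≤ b)
    (hS : Icc a b ⊆ survivors f δ n) : SurjOn f^[n] (Icc a b) (Icc (f^[n] a) (f^[n] b)) :=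
  intermediate_value_Icc hab (h.continuousOn_iterate hS)

/-! ### Bounded distortion -/

/-- Cauchy's mean value theorem for `log f'` against `f` produces the quotient `f'' / f' ^ 2`, so
the variation is measured by the length of the image, not of the interval. -/
theorem abs_log_deriv_sub_le (h : LorenzBounds f α lam M ρ) {δ u v : ℝ} (hδ : 0 < δ)
    (huv : u < v) (hS : Icc u v ⊆ domInt) (hS' : ∀ x ∈ Icc u v, δ ≤ |x|) :
    |Real.log (deriv f v) - Real.log (deriv f u)| ≤ M * δ ^ (-α) * (f v - f u) := by
  have h1 := h.one_lt_lam
  have hpos : ∀ x ∈ Icc u v, 0 < deriv f x := fun x hx => by linarith [h.lam_le x (hS hx)]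
  have hd2 : ∀ x ∈ Icc u v, HasDerivAt (deriv f) (deriv (deriv f) x) x := by
    intro x hx
    have hC : ContDiffOn ℝ 2 f domInt := fun y hy => (h.contDiffAt y hy).contDiffWithinAt
    have hC1 : ContDiffAt ℝ 1 (deriv f) x :=
      (hC.deriv_of_isOpen isOpen_domInt (by norm_num)).contDiffAt
        (isOpen_domInt.mem_nhds (hS hx))
    exact (hC1.differentiableAt (by norm_num)).hasDerivAt
  have hl : ∀ x ∈ Icc u v, HasDerivAt (fun x => Real.log (deriv f x))
      (deriv (deriv f) x / deriv f x) x := fun x hx => (hd2 x hx).log (hpos x hx).ne'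
  have hd1 : ∀ x ∈ Icc u v, HasDerivAt f (deriv f x) x := fun x hx =>
    (h.differentiableAt (hS hx)).hasDerivAt
  obtain ⟨ξ, hξ, heq⟩ := exists_ratio_hasDerivAt_eq_ratio_slope _ _ huv
    (fun x hx => (hl x hx).continuousAt.continuousWithinAt)
    (fun x hx => hl x (Ioo_subset_Icc_self hx)) f (deriv f)
    (fun x hx => (hd1 x hx).continuousAt.continuousWithinAt)
    (fun x hx => hd1 x (Ioo_subset_Icc_self hx))
  have hξ' := Ioo_subset_Icc_self hξ
  have hg := hpos ξ hξ'
  have hfuv : 0 ≤ f v - f u := by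
    have e1 := h.expand huv.le hS
    have e2 := sub_pos.2 huv
    have : 0 < lam * (v - u) := by positivity
    linarith
  have e1 := h.abs_deriv2_le ξ (hS hξ')
  have e2 : |ξ| ^ (-α) ≤ δ ^ (-α) :=
    Real.rpow_le_rpow_of_nonpos hδ (hS' ξ hξ') (by linarith [h.alpha_pos])
  have hM := h.M_pos
  have e3 : Real.log (deriv f v) - Real.log (deriv f u) =
      (f v - f u) * (deriv (deriv f) ξ / deriv f ξ ^ 2) := by
    field_simp
    field_simp at heq
    linarith
  rw [e3, abs_mul, abs_of_nonneg hfuv, abs_div, abs_of_pos (pow_pos hg 2), mul_comm]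
  gcongr
  rw [div_le_iff₀ (pow_pos hg 2)]
  refine e1.trans ?_
  gcongr

/-- The images of `[u, v]` grow geometrically, so the one-step variations sum up to a multiple of
the last image length. -/
theorem abs_log_deriv_iterate_sub_le (h : LorenzBounds f α lam M ρ) {δ : ℝ} (hδ : 0 < δ) {n : ℕ} :
    ∀ {u v : ℝ}, u ≤ v → Icc u v ⊆ survivors f δ n →
      |Real.log (deriv f^[n] v) - Real.log (deriv f^[n] u)| ≤
        4 * M * δ ^ (-α) * (f^[n] v - f^[n] u) := by
  have h1 := h.one_lt_lam
  induction n with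
  | zero =>
    intro u v huv _
    have : 0 ≤ 4 * M * δ ^ (-α) * (v - u) := by
      have := h.M_pos
      have := sub_nonneg.2 huv
      positivity
    simpa using this
  | succ n ih =>
    intro u v huv hS
    rcases huv.eq_or_lt with rfl | hlt
    · simp
    have hSn : Icc u v ⊆ survivors f δ n := fun x hx => (survivors_succ.1 (hS hx)).1
    have hu : u ∈ Icc u v := left_mem_Icc.2 huv
    have hv : v ∈ Icc u v := right_mem_Icc.2 huv
    have hfuv := h.strictMonoOn_iterate hSn hu hv hlt
    have himg : ∀ y ∈ Icc (f^[n] u) (f^[n] v), y ∈ domInt ∧ δ ≤ |y| := by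
      intro y hy
      obtain ⟨x, hx, rfl⟩ := h.surjOn huv hSn hy
      exact (survivors_succ.1 (hS hx)).2
    have e1 := h.abs_log_deriv_sub_le hδ hfuv (fun y hy => (himg y hy).1)
      (fun y hy => (himg y hy).2)
    have e2 := ih huv hSn
    have e3 := h.expand hfuv.le (fun y hy => (himg y hy).1)
    have hpos1 : ∀ x ∈ Icc u v, 0 < deriv f^[n] x := fun x hx =>
      lt_of_lt_of_le (by positivity) (h.pow_le_deriv_iterate (hSn hx))
    have hpos2 : ∀ x ∈ Icc u v, 0 < deriv f (f^[n] x) := fun x hx => by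
      linarith [h.lam_le _ (survivors_succ.1 (hS hx)).2.1]
    rw [h.deriv_iterate_succ (hS hu), h.deriv_iterate_succ (hS hv),
      Real.log_mul (hpos2 v hv).ne' (hpos1 v hv).ne',
      Real.log_mul (hpos2 u hu).ne' (hpos1 u hu).ne']
    rw [Function.iterate_succ_apply', Function.iterate_succ_apply']
    set A := M * δ ^ (-α) with hA
    have hA0 : 0 ≤ A := by
      have := h.M_pos
      positivity
    -- The constant `4` closes the induction because `4 ≤ 3 * (7 / 5)`: the earlier steps use `3`
    -- parts of the new bound and the last step uses `1`.
    have e4 : A * (4 * (f^[n] v - f^[n] u)) ≤ A * (3 * (f (f^[n] v) - f (f^[n] u))) := by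
      have := h.le_lam
      have := sub_pos.2 hfuv
      refine mul_le_mul_of_nonneg_left ?_ hA0
      nlinarith
    have e5 : 4 * M * δ ^ (-α) * (f^[n] v - f^[n] u) = A * (4 * (f^[n] v - f^[n] u)) := by
      rw [hA]; ring
    have e6 : 4 * M * δ ^ (-α) * (f (f^[n] v) - f (f^[n] u)) =
        A * (3 * (f (f^[n] v) - f (f^[n] u))) + A * (f (f^[n] v) - f (f^[n] u)) := by
      rw [hA]; ring
    rw [e5] at e2
    rw [e6]
    rw [abs_le] at e1 e2 ⊢
    constructor <;> linarith [e1.1, e1.2, e2.1, e2.2]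

/-- Branches whose image is not longer than `δ ^ α` have uniformly bounded distortion. -/
theorem distortion (h : LorenzBounds f α lam M ρ) {δ : ℝ} (hδ : 0 < δ) {n : ℕ} {a b : ℝ}
    (hS : Icc a b ⊆ survivors f δ n) (hlen : f^[n] b - f^[n] a ≤ δ ^ α)
    {x y x' y' : ℝ} (hx : a ≤ x) (hxy : x < y) (hy : y ≤ b) (hx' : a ≤ x') (hxy' : x' < y')
    (hy' : y' ≤ b) :
    (f^[n] y - f^[n] x) * (y' - x') ≤ Real.exp (4 * M) * (f^[n] y' - f^[n] x') * (y - x) := by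
  have h1 := h.one_lt_lam
  have mvt : ∀ {s t : ℝ}, a ≤ s → s < t → t ≤ b → ∃ ξ ∈ Icc a b,
      f^[n] t - f^[n] s = deriv f^[n] ξ * (t - s) := by
    intro s t has hst htb
    have hsub : Icc s t ⊆ Icc a b := Icc_subset_Icc has htb
    obtain ⟨ξ, hξ, he⟩ := exists_deriv_eq_slope f^[n] hst
      (h.continuousOn_iterate (hsub.trans hS))
      (fun z hz => (h.differentiableAt_iterate
        (hS (hsub (Ioo_subset_Icc_self hz)))).differentiableWithinAt)
    refine ⟨ξ, hsub (Ioo_subset_Icc_self hξ), ?_⟩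
    rw [he, div_mul_cancel₀ _ (sub_pos.2 hst).ne']
  have hpos : ∀ z ∈ Icc a b, 0 < deriv f^[n] z := fun z hz =>
    lt_of_lt_of_le (by positivity) (h.pow_le_deriv_iterate (hS hz))
  have hdist : ∀ {s t : ℝ}, s ∈ Icc a b → t ∈ Icc a b → s ≤ t →
      |Real.log (deriv f^[n] t) - Real.log (deriv f^[n] s)| ≤ 4 * M := by
    intro s t hs ht hst
    refine (h.abs_log_deriv_iterate_sub_le hδ hst
      ((Icc_subset_Icc hs.1 ht.2).trans hS)).trans ?_
    have e1 := (h.image_subset hS hs).1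
    have e2 := (h.image_subset hS ht).2
    have e3 : f^[n] t - f^[n] s ≤ δ ^ α := by linarith
    have hM := h.M_pos
    calc 4 * M * δ ^ (-α) * (f^[n] t - f^[n] s) ≤ 4 * M * δ ^ (-α) * δ ^ α := by gcongr
      _ = 4 * M := by rw [mul_assoc, ← Real.rpow_add hδ]; simp
  obtain ⟨ξ, hξ, e1⟩ := mvt hx hxy hy
  obtain ⟨ξ', hξ', e2⟩ := mvt hx' hxy' hy'
  have e3 : Real.log (deriv f^[n] ξ) ≤ 4 * M + Real.log (deriv f^[n] ξ') := by
    rcases le_total ξ ξ' with hle | hle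
    · linarith [(abs_le.1 (hdist hξ hξ' hle)).1]
    · linarith [(abs_le.1 (hdist hξ' hξ hle)).2]
  have e4 : deriv f^[n] ξ ≤ Real.exp (4 * M) * deriv f^[n] ξ' := by
    rw [← Real.log_le_log_iff (hpos ξ hξ) (mul_pos (Real.exp_pos _) (hpos ξ' hξ')),
      Real.log_mul (Real.exp_pos _).ne' (hpos ξ' hξ').ne', Real.log_exp]
    exact e3
  rw [e1, e2]
  have e5 := sub_pos.2 hxy
  have e6 := sub_pos.2 hxy'
  calc deriv f^[n] ξ * (y - x) * (y' - x')
      ≤ (Real.exp (4 * M) * deriv f^[n] ξ') * (y - x) * (y' - x') := by gcongr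
    _ = _ := by ring

end LorenzBounds

/-! ### Every interval contains a full branch -/

/-- The interval `[c, d]` contains an interval which is mapped monotonically onto `[p, q]` by
an iterate of `f`. -/
def HasFullBranch (f : ℝ → ℝ) (p q c d : ℝ) : Prop :=
  ∃ (k : ℕ) (c' d' : ℝ), c ≤ c' ∧ c' < d' ∧ d' ≤ d ∧ Icc c' d' ⊆ survivors f 0 k ∧
    f^[k] c' = p ∧ f^[k] d' = q

theorem HasFullBranch.mono {f : ℝ → ℝ} {p q c d c₁ d₁ : ℝ} (h : HasFullBranch f p q c₁ d₁)
    (hc : c ≤ c₁) (hd : d₁ ≤ d) : HasFullBranch f p q c d := by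
  obtain ⟨k, c', d', h1, h2, h3, h4⟩ := h
  exact ⟨k, c', d', hc.trans h1, h2, h3.trans hd, h4⟩

theorem subset_survivors_one {f : ℝ → ℝ} {S : Set ℝ} (h : S ⊆ domInt) : S ⊆ survivors f 0 1 := by
  intro x hx
  refine ⟨(h hx).1, fun i hi => ?_⟩
  obtain rfl : i = 0 := by omega
  exact ⟨h hx, abs_nonneg _⟩

namespace LorenzBounds

variable {f : ℝ → ℝ} {α lam M ρ p q : ℝ}

theorem hasFullBranch_of_image (h : LorenzBounds f α lam M ρ) {n : ℕ} {a b : ℝ} (hab : a ≤ b)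
    (hS : Icc a b ⊆ survivors f 0 n) (hb : HasFullBranch f p q (f^[n] a) (f^[n] b)) :
    HasFullBranch f p q a b := by
  obtain ⟨k, c, d, h1, h2, h3, h4, rfl, rfl⟩ := hb
  obtain ⟨a', b', ha, hab', hb, rfl, rfl⟩ := h.exists_pullback hab hS h1 h2 h3
  have hsub := (Icc_subset_Icc ha hb).trans hS
  refine ⟨k + n, a', b', ha, hab', hb, fun x hx => ?_, Function.iterate_add_apply _ _ _ _,
    Function.iterate_add_apply _ _ _ _⟩
  rw [add_comm]
  exact mem_survivors_add (hsub hx) (h4 (h.image_subset hsub hx))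

theorem exists_eq_right (h : LorenzBounds f α lam M ρ) {y z : ℝ} (hy : 0 < y) (hy' : y < 1 / 2)
    (hz : -1 / 2 < z) (hzy : z < f y) : ∃ x ∈ Ioo 0 y, f x = z := by
  have e1 : ∀ᶠ t in 𝓝[>] (0 : ℝ), f t < z := h.lim_right.eventually_lt_const hz
  have e2 : ∀ᶠ t in 𝓝[>] (0 : ℝ), t ∈ Ioo 0 y := Ioo_mem_nhdsGT hy
  obtain ⟨t, ht1, ht2⟩ := (e1.and e2).exists
  have hsub : Icc t y ⊆ domInt :=
    Icc_subset_domInt (by linarith [ht2.1]) hy' (Or.inl ht2.1)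
  obtain ⟨x, hx, rfl⟩ := intermediate_value_Icc ht2.2.le
    (fun x hx => (h.differentiableAt (hsub hx)).continuousAt.continuousWithinAt) ⟨ht1.le, hzy.le⟩
  refine ⟨x, ⟨ht2.1.trans_le hx.1, lt_of_le_of_ne hx.2 ?_⟩, rfl⟩
  rintro rfl
  exact lt_irrefl _ hzy

theorem exists_eq_left (h : LorenzBounds f α lam M ρ) {y z : ℝ} (hy : y < 0) (hy' : -1 / 2 < y)
    (hz : z < 1 / 2) (hzy : f y < z) : ∃ x ∈ Ioo y 0, f x = z := by
  have e1 : ∀ᶠ t in 𝓝[<] (0 : ℝ), z < f t := h.lim_left.eventually_const_lt hz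
  have e2 : ∀ᶠ t in 𝓝[<] (0 : ℝ), t ∈ Ioo y 0 := Ioo_mem_nhdsLT hy
  obtain ⟨t, ht1, ht2⟩ := (e1.and e2).exists
  have hsub : Icc y t ⊆ domInt :=
    Icc_subset_domInt hy' (by linarith [ht2.2]) (Or.inr ht2.2)
  obtain ⟨x, hx, rfl⟩ := intermediate_value_Icc ht2.1.le
    (fun x hx => (h.differentiableAt (hsub hx)).continuousAt.continuousWithinAt) ⟨hzy.le, ht1.le⟩
  refine ⟨x, ⟨lt_of_le_of_ne hx.1 ?_, hx.2.trans_lt ht2.2⟩, rfl⟩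
  rintro rfl
  exact lt_irrefl _ hzy

theorem exists_eq_of_nonneg (h : LorenzBounds f α lam M ρ) {z : ℝ} (hz : 0 ≤ z)
    (hz' : z < 1 / 2) : ∃ x ∈ Ioo (-1 / 2 : ℝ) 0, f x = z := by
  -- This interval has length `48 / 100`, hence an image longer than `1 / 2`; as that image ends
  -- below `1 / 2`, it starts below `0`.
  have hsub : Icc (-49 / 100 : ℝ) (-1 / 100) ⊆ domInt :=
    Icc_subset_domInt (by norm_num) (by norm_num) (Or.inr (by norm_num))
  have e1 := h.expand (by norm_num) hsub
  have e2 := (h.mapsTo (hsub (right_mem_Icc.2 (by norm_num)))).2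
  have e3 := h.le_lam
  obtain ⟨x, hx, hxz⟩ := h.exists_eq_left (y := -49 / 100) (z := z) (by norm_num) (by norm_num) hz'
    (by nlinarith)
  exact ⟨x, ⟨by linarith [hx.1], hx.2⟩, hxz⟩

theorem hasFullBranch_left (h : LorenzBounds f α lam M ρ) (hp : 0 < p) (hpq : p < q)
    (hq : q < 1 / 2) : ∃ u v, -1 / 2 < u ∧ v < 0 ∧ HasFullBranch f p q u v := by
  obtain ⟨u, hu, hup⟩ := h.exists_eq_of_nonneg hp.le (hpq.trans hq)
  obtain ⟨v, hv, hvq⟩ := h.exists_eq_of_nonneg (hp.trans hpq).le hq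
  have huv : u < v := by
    by_contra! hle
    have e1 := h.expand hle (Icc_subset_domInt hv.1 (by linarith [hu.2]) (Or.inr hu.2))
    have e2 := h.one_lt_lam
    have e3 := sub_nonneg.2 hle
    nlinarith
  exact ⟨u, v, hu.1, hv.2, 1, u, v, le_rfl, huv, le_rfl,
    subset_survivors_one (Icc_subset_domInt hu.1 (by linarith [hv.2]) (Or.inr hv.2)), hup, hvq⟩

theorem hasFullBranch_of_expand (h : LorenzBounds f α lam M ρ) {c d : ℝ} (hcd : c ≤ d)
    (hS : Icc c d ⊆ domInt) (hb : HasFullBranch f p q (f c) (f d)) : HasFullBranch f p q c d :=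
  h.hasFullBranch_of_image (n := 1) hcd (subset_survivors_one hS) hb

/-- If `0` is outside `[c, d]`, one step expands. Otherwise keep the longer half. Should its image
cross `0`, that image covers one whole side of the singularity: the positive side is reached by the
left half, which then covers `[p, q]` directly, and the negative side by the right half, where one
more step is needed. If the image does not cross `0`, two steps expand the half by `lam ^ 2 > 2`,
which beats the halving. -/
theorem hasFullBranch_or_grow (h : LorenzBounds f α lam M ρ) (hp : 0 < p) (hpq : p < q)
    (hq : q < 1 / 2) {c d : ℝ} (hc : -1 / 2 < c) (hcd : c < d) (hd : d < 1 / 2) :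
    HasFullBranch f p q c d ∨ ∃ c₁ d₁, -1 / 2 < c₁ ∧ c₁ < d₁ ∧ d₁ < 1 / 2 ∧
      (lam ^ 2 + 2) / 4 * (d - c) ≤ d₁ - c₁ ∧
      (HasFullBranch f p q c₁ d₁ → HasFullBranch f p q c d) := by
  have hl1 := h.le_lam
  have hl2 := h.lam_le_two
  have hl3 := h.two_lt_sq
  -- the half of the interval on one side of `0`, shrunk by `θ` at both ends, grows in two steps
  set θ := (lam ^ 2 - 2) / (4 * lam ^ 2) with hθ
  have hθ0 : 0 < θ := div_pos (by linarith) (by positivity)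
  have hθ2 : θ < 1 / 4 := by
    rw [hθ, div_lt_iff₀ (by positivity)]
    linarith
  have hθl : lam ^ 2 * (1 - 2 * θ) = (lam ^ 2 + 2) / 2 := by
    rw [hθ]
    field_simp
    ring
  have two_steps : ∀ {s t w : ℝ}, s < t → Icc s t ⊆ domInt → Icc (f s) (f t) ⊆ domInt →
      (1 - 2 * θ) * w ≤ t - s → d - c ≤ 2 * w → c ≤ s → t ≤ d →
      ∃ c₁ d₁, -1 / 2 < c₁ ∧ c₁ < d₁ ∧ d₁ < 1 / 2 ∧
      (lam ^ 2 + 2) / 4 * (d - c) ≤ d₁ - c₁ ∧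
      (HasFullBranch f p q c₁ d₁ → HasFullBranch f p q c d) := by
    intro s t w hst h1 h2 hw hdw hcs htd
    have e1 := h.expand hst.le h1
    have est := sub_pos.2 hst
    have hf : f s < f t := by nlinarith
    have e2 := h.expand hf.le h2
    have e3 : f (f s) < f (f t) := by nlinarith
    refine ⟨f (f s), f (f t), (h.mapsTo (h2 (left_mem_Icc.2 hf.le))).1, e3,
      (h.mapsTo (h2 (right_mem_Icc.2 hf.le))).2, ?_, fun hb => ?_⟩
    · calc (lam ^ 2 + 2) / 4 * (d - c) ≤ (lam ^ 2 + 2) / 4 * (2 * w) := by gcongr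
        _ = lam ^ 2 * ((1 - 2 * θ) * w) := by rw [← mul_assoc (lam ^ 2), hθl]; ring
        _ ≤ lam ^ 2 * (t - s) := by gcongr
        _ = lam * (lam * (t - s)) := by ring
        _ ≤ lam * (f t - f s) := by gcongr
        _ ≤ _ := e2
    · exact (h.hasFullBranch_of_expand hst.le h1
        (h.hasFullBranch_of_expand hf.le h2 hb)).mono hcs htd
  by_cases h0 : 0 < c ∨ d < 0
  · have hS := Icc_subset_domInt hc hd h0
    have e1 := h.expand hcd.le hS
    have e2 := sub_pos.2 hcd
    refine Or.inr ⟨f c, f d, (h.mapsTo (hS (left_mem_Icc.2 hcd.le))).1, by nlinarith,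
      (h.mapsTo (hS (right_mem_Icc.2 hcd.le))).2, ?_, h.hasFullBranch_of_expand hcd.le hS⟩
    -- `(lam ^ 2 + 2) / 4 ≤ lam` holds for `7 / 5 ≤ lam ≤ 2`.
    refine le_trans ?_ e1
    gcongr
    nlinarith
  · rw [not_or, not_lt, not_lt] at h0
    rcases le_total (d - c) (2 * d) with hw | hw
    · have hd0 : 0 < d := by linarith
      have hdD : d ∈ domInt := ⟨⟨by linarith, hd⟩, hd0.ne'⟩
      by_cases hfd : 0 < f d
      · obtain ⟨u, v, hu, hv, hb⟩ := h.hasFullBranch_left hp hpq hq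
        have huv : u < v := by
          obtain ⟨k, c', d', h1, h2, h3, -⟩ := hb
          linarith
        obtain ⟨u', hu', rfl⟩ := h.exists_eq_right hd0 hd hu (by linarith)
        obtain ⟨v', hv', rfl⟩ := h.exists_eq_right hd0 hd (hu.trans huv) (by linarith)
        have huv' : u' ≤ v' := by
          by_contra! hle
          have e1 := h.expand hle.le
            (Icc_subset_domInt (by linarith [hv'.1]) (by linarith [hu'.2]) (Or.inl hv'.1))
          have e3 := sub_pos.2 hle
          nlinarith
        exact Or.inl ((h.hasFullBranch_of_expand huv' (Icc_subset_domInt (by linarith [hu'.1])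
          (by linarith [hv'.2]) (Or.inl hu'.1)) hb).mono (by linarith [hu'.1]) hv'.2.le)
      · have hlt : θ * d < (1 - θ) * d := by nlinarith
        have h1 : 0 < θ * d := by positivity
        have h2 : (1 - θ) * d < d := by nlinarith
        have hS : Icc (θ * d) d ⊆ domInt := Icc_subset_domInt (by linarith) hd (Or.inl h1)
        have hS1 : Icc (θ * d) ((1 - θ) * d) ⊆ domInt := (Icc_subset_Icc le_rfl h2.le).trans hS
        have e1 := h.expand h2.le ((Icc_subset_Icc hlt.le le_rfl).trans hS)
        have e2 := h.mapsTo (hS1 (left_mem_Icc.2 hlt.le))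
        have e3 := h.mapsTo (hS1 (right_mem_Icc.2 hlt.le))
        refine Or.inr (two_steps (w := d) hlt hS1
          (Icc_subset_domInt e2.1 e3.2 (Or.inr ?_)) (by linarith) hw (by linarith) h2.le)
        have := sub_pos.2 h2
        nlinarith
    · have hc0 : c < 0 := by linarith
      by_cases hfc : f c < 0
      · obtain ⟨u, hu, rfl⟩ := h.exists_eq_left hc0 hc (hpq.trans hq) (hfc.trans hp)
        obtain ⟨v, hv, rfl⟩ := h.exists_eq_left hc0 hc hq (hfc.trans (hp.trans hpq))
        have huv : u < v := by
          by_contra! hle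
          have e1 := h.expand hle
            (Icc_subset_domInt (by linarith [hv.1]) (by linarith [hu.2]) (Or.inr hu.2))
          have e3 := sub_nonneg.2 hle
          nlinarith
        exact Or.inl ⟨1, u, v, hu.1.le, huv, by linarith [hv.2], subset_survivors_one
          (Icc_subset_domInt (by linarith [hu.1]) (by linarith [hv.2]) (Or.inr hv.2)), rfl, rfl⟩
      · have hlt : (1 - θ) * c < θ * c := by nlinarith
        have h1 : θ * c < 0 := by nlinarith
        have h2 : c < (1 - θ) * c := by nlinarith
        have hS : Icc c (θ * c) ⊆ domInt := Icc_subset_domInt hc (by linarith) (Or.inr h1)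
        have hS1 : Icc ((1 - θ) * c) (θ * c) ⊆ domInt := (Icc_subset_Icc h2.le le_rfl).trans hS
        have e1 := h.expand h2.le ((Icc_subset_Icc le_rfl hlt.le).trans hS)
        have e2 := h.mapsTo (hS1 (left_mem_Icc.2 hlt.le))
        have e3 := h.mapsTo (hS1 (right_mem_Icc.2 hlt.le))
        refine Or.inr (two_steps (w := -c) hlt hS1
          (Icc_subset_domInt e2.1 e3.2 (Or.inl ?_)) (by linarith) (by linarith) h2.le (by linarith))
        have := sub_pos.2 h2
        nlinarith

/-- Growth by a fixed factor larger than `1` cannot be repeated forever inside an interval of length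
`1`, so the other alternative must occur. -/
theorem hasFullBranch (h : LorenzBounds f α lam M ρ) (hp : 0 < p) (hpq : p < q)
    (hq : q < 1 / 2) {c d : ℝ} (hc : -1 / 2 < c) (hcd : c < d) (hd : d < 1 / 2) :
    HasFullBranch f p q c d := by
  set μ := (lam ^ 2 + 2) / 4 with hμ
  have hμ1 : 1 < μ := by
    have := h.two_lt_sq
    rw [hμ]
    linarith
  have key : ∀ n : ℕ, ∀ c d : ℝ, -1 / 2 < c → c < d → d < 1 / 2 → 1 ≤ μ ^ n * (d - c) →
      HasFullBranch f p q c d := by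
    intro n
    induction n with
    | zero =>
      intro c d hc hcd hd hle
      rw [pow_zero, one_mul] at hle
      linarith
    | succ n ih =>
      intro c d hc hcd hd hle
      rcases h.hasFullBranch_or_grow hp hpq hq hc hcd hd with hb | ⟨c₁, d₁, h1, h2, h3, h4, h5⟩
      · exact hb
      · refine h5 (ih c₁ d₁ h1 h2 h3 (hle.trans ?_))
        rw [pow_succ, mul_assoc]
        gcongr
  have hpos := sub_pos.2 hcd
  obtain ⟨n, hn⟩ := pow_unbounded_of_one_lt (1 / (d - c)) hμ1
  rw [div_lt_iff₀ hpos] at hn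
  exact key n c d hc hcd hd hn.le

/-- An iterate is Lipschitz along each of its branches. -/
theorem exists_lipschitz (h : LorenzBounds f α lam M ρ) {δ : ℝ} {n : ℕ} {a b : ℝ}
    (hS : Icc a b ⊆ survivors f δ n) :
    ∃ Λ > 0, ∀ x y, a ≤ x → x ≤ y → y ≤ b → f^[n] y - f^[n] x ≤ Λ * (y - x) := by
  have hloc : LocallyLipschitzOn (Icc a b) f^[n] := by
    intro x hx
    obtain ⟨K, t, ht, hKt⟩ :=
      ((h.contDiffAt_iterate (hS hx)).of_le (by norm_num : (1 : WithTop ℕ∞) ≤ 2)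
        ).exists_lipschitzOnWith
    exact ⟨K, t, mem_nhdsWithin_of_mem_nhds ht, hKt⟩
  obtain ⟨C, hC⟩ := hloc.exists_lipschitzOnWith_of_compact isCompact_Icc
  refine ⟨C + 1, by positivity, fun x y hx hxy hy => ?_⟩
  have e1 := hC.dist_le_mul y ⟨hx.trans hxy, hy⟩ x ⟨hx, hxy.trans hy⟩
  rw [Real.dist_eq, Real.dist_eq, abs_of_nonneg (sub_nonneg.2 hxy)] at e1
  have e2 := le_abs_self (f^[n] y - f^[n] x)
  have e3 := sub_nonneg.2 hxy
  linarith

/-- Full branches inside intervals of length at least `η`, with a uniform Lipschitz constant. -/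
theorem hasFullBranch_uniform (h : LorenzBounds f α lam M ρ) (hp : 0 < p) (hpq : p < q)
    (hq : q < 1 / 2) {η : ℝ} (hη : 0 < η) :
    ∃ Λ > 0, ∀ c d, -1 / 2 < c → c + η ≤ d → d < 1 / 2 →
      ∃ (k : ℕ) (c' d' : ℝ), c ≤ c' ∧ c' < d' ∧ d' ≤ d ∧ Icc c' d' ⊆ survivors f 0 k ∧
        f^[k] c' = p ∧ f^[k] d' = q ∧
        ∀ x y, c' ≤ x → x ≤ y → y ≤ d' → f^[k] y - f^[k] x ≤ Λ * (y - x) := by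
  -- Every interval of length `η` contains a cell of the grid of mesh `η / 2`. Only finitely many
  -- cells are relevant, so choosing one branch per cell makes the Lipschitz constant uniform.
  have hcell : ∀ j : ℤ, ∃ Λ > 0, ∀ c d, -1 / 2 < c → d < 1 / 2 → c ≤ j * (η / 2) →
      (j + 1) * (η / 2) ≤ d → ∃ (k : ℕ) (c' d' : ℝ), c ≤ c' ∧ c' < d' ∧ d' ≤ d ∧
        Icc c' d' ⊆ survivors f 0 k ∧ f^[k] c' = p ∧ f^[k] d' = q ∧
        ∀ x y, c' ≤ x → x ≤ y → y ≤ d' → f^[k] y - f^[k] x ≤ Λ * (y - x) := by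
    intro j
    by_cases hj : -1 / 2 < j * (η / 2) ∧ (j + 1) * (η / 2) < 1 / 2
    · obtain ⟨k, c', d', h1, h2, h3, h4, h5, h6⟩ :=
        h.hasFullBranch hp hpq hq hj.1 (by linarith) hj.2
      obtain ⟨Λ, hΛ, hL⟩ := h.exists_lipschitz h4
      exact ⟨Λ, hΛ, fun c d _ _ hc hd =>
        ⟨k, c', d', hc.trans h1, h2, h3.trans hd, h4, h5, h6, hL⟩⟩
    -- A cell that leaves the open interval `(-1/2, 1/2)` lies in no admissible `[c, d]`, so any
    -- constant will do.
    · refine ⟨1, one_pos, fun c d hc hd hcj hjd => absurd ⟨?_, ?_⟩ hj⟩ <;> linarith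
  choose Λ hΛ hcell using hcell
  obtain ⟨N, hN⟩ := exists_nat_gt (1 / η)
  obtain ⟨B, hB⟩ := ((Finset.Icc (-(N : ℤ) - 1) (N + 1)).image Λ).exists_le
  refine ⟨max B 1, by positivity, fun c d hc hcd hd => ?_⟩
  have hη2 : 0 < η / 2 := by positivity
  set j := ⌈c / (η / 2)⌉ with hj
  have hj1 : c ≤ j * (η / 2) := by
    rw [← div_le_iff₀ hη2]
    exact Int.le_ceil _
  have hj2 : (j - 1) * (η / 2) < c := by
    rw [← lt_div_iff₀ hη2]
    have := Int.ceil_lt_add_one (c / (η / 2))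
    rw [← hj] at this
    linarith
  rw [div_lt_iff₀ hη] at hN
  have hjN : j ∈ Finset.Icc (-(N : ℤ) - 1) (N + 1) := by
    rw [Finset.mem_Icc]
    constructor
    · have : (-(N : ℝ) - 1) ≤ j := by
        refine le_of_mul_le_mul_right ?_ hη2
        nlinarith
      exact_mod_cast this
    · have : (j : ℝ) ≤ N + 1 := by
        refine le_of_mul_le_mul_right ?_ hη2
        nlinarith
      exact_mod_cast this
  have hΛB := hB _ (Finset.mem_image_of_mem Λ hjN)
  obtain ⟨k, c', d', h1, h2, h3, h4, h5, h6, h7⟩ := hcell j c d hc hd hj1 (by linarith)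
  refine ⟨k, c', d', h1, h2, h3, h4, h5, h6, fun x y hx hxy hy => (h7 x y hx hxy hy).trans ?_⟩
  have := sub_nonneg.2 hxy
  gcongr
  exact hΛB.trans (le_max_left _ _)

end LorenzBounds

/-! ### Families of short branches avoiding a neighbourhood of the singularity -/

/-- An interval `[a, b]` with a weight `w`. -/
structure Piece where
  a : ℝ
  b : ℝ
  w : ℝ

/-- `[u.a, u.b]` is a branch of `f^[n]` avoiding `(-δ, δ)`, with image not longer than `η`, and
the inverse branch is Lipschitz with constant `u.w`. -/
structure Piece.Good (f : ℝ → ℝ) (δ η : ℝ) (n : ℕ) (u : Piece) : Prop where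
  lt : u.a < u.b
  subset : Icc u.a u.b ⊆ survivors f δ n
  len : f^[n] u.b - f^[n] u.a ≤ η
  weight : ∀ x y, u.a ≤ x → x ≤ y → y ≤ u.b → y - x ≤ u.w * (f^[n] y - f^[n] x)

/-- An increasing list of good pieces inside `[a, b]`. -/
structure IsFamily (f : ℝ → ℝ) (δ η : ℝ) (n : ℕ) (a b : ℝ) (L : List Piece) : Prop where
  pairwise : L.Pairwise fun u v => u.b ≤ v.a
  good : ∀ u ∈ L, u.Good f δ η n
  left_le : ∀ u ∈ L, a ≤ u.a
  le_right : ∀ u ∈ L, u.b ≤ b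

/-- The total length of a list of pieces. -/
def mass (L : List Piece) : ℝ := (L.map fun u => u.b - u.a).sum

/-- The total weight of a list of pieces. -/
def weight (L : List Piece) : ℝ := (L.map fun u => u.w).sum

theorem mass_nil : mass [] = 0 := rfl

theorem weight_nil : weight [] = 0 := rfl

theorem mass_cons (u : Piece) (L : List Piece) : mass (u :: L) = u.b - u.a + mass L := by
  simp [mass]

theorem weight_cons (u : Piece) (L : List Piece) : weight (u :: L) = u.w + weight L := by
  simp [weight]

theorem mass_append (L L' : List Piece) : mass (L ++ L') = mass L + mass L' := by
  simp [mass]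

theorem weight_append (L L' : List Piece) : weight (L ++ L') = weight L + weight L' := by
  simp [weight]

section Family

variable {f : ℝ → ℝ} {α lam M ρ δ η : ℝ} {n : ℕ}

theorem isFamily_nil (a b : ℝ) : IsFamily f δ η n a b [] :=
  ⟨List.Pairwise.nil, by simp, by simp, by simp⟩

theorem isFamily_singleton {u : Piece} (hu : u.Good f δ η n) : IsFamily f δ η n u.a u.b [u] :=
  ⟨List.pairwise_singleton _ _, by simpa using hu, by simp, by simp⟩

theorem IsFamily.append {a b c d : ℝ} {L L' : List Piece} (h : IsFamily f δ η n a b L)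
    (h' : IsFamily f δ η n c d L') (hac : a ≤ c) (hbc : b ≤ c) (hbd : b ≤ d) :
    IsFamily f δ η n a d (L ++ L') := by
  refine ⟨List.pairwise_append.2 ⟨h.pairwise, h'.pairwise, fun u hu v hv =>
    (h.le_right u hu).trans (hbc.trans (h'.left_le v hv))⟩, fun u hu => ?_, fun u hu => ?_,
    fun u hu => ?_⟩ <;> rcases List.mem_append.1 hu with hu | hu
  · exact h.good u hu
  · exact h'.good u hu
  · exact h.left_le u hu
  · exact hac.trans (h'.left_le u hu)
  · exact (h.le_right u hu).trans hbd
  · exact h'.le_right u hu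

theorem Piece.Good.weight_nonneg (h : LorenzBounds f α lam M ρ) {u : Piece}
    (hu : u.Good f δ η n) : 0 ≤ u.w := by
  have e1 := hu.weight u.a u.b le_rfl hu.lt.le le_rfl
  have e2 := h.strictMonoOn_iterate hu.subset (left_mem_Icc.2 hu.lt.le)
    (right_mem_Icc.2 hu.lt.le) hu.lt
  have e3 := sub_pos.2 hu.lt
  by_contra! hneg
  have := mul_pos_of_neg_of_neg hneg (sub_neg.2 e2)
  nlinarith

namespace LorenzBounds

/-- A branch with image of length between `η / 2` and `η` is a good piece with controlled weight. -/
theorem good_of_half_le (h : LorenzBounds f α lam M ρ) (hδ : 0 < δ) (hη : η = δ ^ α) {a b : ℝ}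
    (hab : a < b) (hS : Icc a b ⊆ survivors f δ n) (h1 : η / 2 ≤ f^[n] b - f^[n] a)
    (h2 : f^[n] b - f^[n] a ≤ η) :
    ∃ w, Piece.Good f δ η n ⟨a, b, w⟩ ∧ w ≤ 2 * Real.exp (4 * M) / η * (b - a) := by
  have hη0 : 0 < η := hη ▸ Real.rpow_pos_of_pos hδ α
  have hpos : 0 < f^[n] b - f^[n] a := by linarith
  -- By bounded distortion the inverse branch has slope at most `exp (4 * M)` times its average
  -- slope.
  refine ⟨Real.exp (4 * M) * (b - a) / (f^[n] b - f^[n] a), ⟨hab, hS, h2, ?_⟩, ?_⟩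
  · intro x y hx hxy hy
    rcases hxy.eq_or_lt with rfl | hlt
    · simp
    · have := h.distortion hδ hS (h2.trans hη.le) le_rfl hab le_rfl hx hlt hy
      simp only at *
      rw [div_mul_eq_mul_div, le_div_iff₀ hpos]
      linarith
  · rw [div_le_iff₀ hpos]
    have e1 : 0 ≤ 2 * Real.exp (4 * M) / η * (b - a) := by
      have := sub_pos.2 hab
      positivity
    refine le_trans (le_of_eq ?_) (mul_le_mul_of_nonneg_left h1 e1)
    field_simp

/-- Bisect the image until it is no longer than `η`. Only images longer than `η` are cut, so every
piece keeps image length at least `η / 2`, which controls its weight by its own length. -/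
theorem exists_subdivide (h : LorenzBounds f α lam M ρ) (hδ : 0 < δ) (hη : η = δ ^ α) (k : ℕ) :
    ∀ {a b : ℝ}, a < b → Icc a b ⊆ survivors f δ n → η / 2 ≤ f^[n] b - f^[n] a →
      f^[n] b - f^[n] a ≤ 2 ^ k * η →
      ∃ L, IsFamily f δ η n a b L ∧ mass L = b - a ∧
        weight L ≤ 2 * Real.exp (4 * M) / η * (b - a) := by
  have base : ∀ {a b : ℝ}, a < b → Icc a b ⊆ survivors f δ n → η / 2 ≤ f^[n] b - f^[n] a →
      f^[n] b - f^[n] a ≤ η →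
      ∃ L, IsFamily f δ η n a b L ∧ mass L = b - a ∧
        weight L ≤ 2 * Real.exp (4 * M) / η * (b - a) := by
    intro a b hab hS h1 h2
    obtain ⟨w, hw, hw'⟩ := h.good_of_half_le hδ hη hab hS h1 h2
    exact ⟨[⟨a, b, w⟩], isFamily_singleton hw, by simp [mass], by simpa [weight] using hw'⟩
  induction k with
  | zero =>
    intro a b hab hS h1 h2
    exact base hab hS h1 (by simpa using h2)
  | succ k ih =>
    intro a b hab hS h1 h2
    by_cases hle : f^[n] b - f^[n] a ≤ η
    · exact base hab hS h1 hle
    · rw [not_le] at hle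
      have hη0 : 0 < η := hη ▸ Real.rpow_pos_of_pos hδ α
      obtain ⟨m, hm, hmid⟩ := h.surjOn hab.le hS
        (show (f^[n] a + f^[n] b) / 2 ∈ Icc (f^[n] a) (f^[n] b) from
          ⟨by linarith, by linarith⟩)
      have ham : a < m := by
        refine lt_of_le_of_ne hm.1 ?_
        rintro rfl
        linarith
      have hmb : m < b := by
        refine lt_of_le_of_ne hm.2 ?_
        rintro rfl
        linarith
      rw [pow_succ] at h2
      obtain ⟨L₁, hL₁, hm₁, hw₁⟩ := ih ham ((Icc_subset_Icc le_rfl hmb.le).trans hS)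
        (by linarith) (by linarith)
      obtain ⟨L₂, hL₂, hm₂, hw₂⟩ := ih hmb ((Icc_subset_Icc ham.le le_rfl).trans hS)
        (by linarith) (by linarith)
      refine ⟨L₁ ++ L₂, hL₁.append hL₂ ham.le le_rfl hmb.le, ?_, ?_⟩
      · rw [mass_append, hm₁, hm₂]
        ring
      · rw [weight_append]
        refine (add_le_add hw₁ hw₂).trans (le_of_eq ?_)
        ring

/-- If the new image is short, the piece is kept and its weight is divided by the expansion `m`. If
it is long, the pieces get fresh weights governed by their lengths. The sum of the two bounds covers
both cases. -/
theorem exists_advance (h : LorenzBounds f α lam M ρ) (hδ : 0 < δ) (hη : η = δ ^ α) {a b w m : ℝ}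
    (hab : a < b) (hS : Icc a b ⊆ survivors f δ n)
    (hw : ∀ x y, a ≤ x → x ≤ y → y ≤ b → y - x ≤ w * (f^[n] y - f^[n] x))
    (hside : δ ≤ f^[n] a ∨ f^[n] b ≤ -δ) (hm : 0 < m)
    (hm' : ∀ z ∈ Icc (f^[n] a) (f^[n] b), z ∈ domInt → m ≤ deriv f z) :
    ∃ L, IsFamily f δ η (n + 1) a b L ∧ mass L = b - a ∧
      weight L ≤ w / m + 2 * Real.exp (4 * M) / η * (b - a) := by
  have hη0 : 0 < η := hη ▸ Real.rpow_pos_of_pos hδ α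
  have ha : a ∈ Icc a b := left_mem_Icc.2 hab.le
  have hb : b ∈ Icc a b := right_mem_Icc.2 hab.le
  have hdom : Icc (f^[n] a) (f^[n] b) ⊆ domInt :=
    Icc_subset_domInt (h.iterate_mem (hS ha)).1 (h.iterate_mem (hS hb)).2
      (hside.imp (fun h => by linarith) (fun h => by linarith))
  have hS1 : Icc a b ⊆ survivors f δ (n + 1) := by
    intro x hx
    have hx' := h.image_subset hS hx
    refine survivors_succ.2 ⟨hS hx, hdom hx', ?_⟩
    rcases hside with h1 | h1
    · exact (h1.trans hx'.1).trans (le_abs_self _)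
    · exact le_trans (by linarith [hx'.2]) (neg_le_abs _)
  have hstep : ∀ x y, a ≤ x → x ≤ y → y ≤ b →
      m * (f^[n] y - f^[n] x) ≤ f^[n + 1] y - f^[n + 1] x := by
    intro x y hx hxy hy
    have hxI : x ∈ Icc a b := ⟨hx, hxy.trans hy⟩
    have hyI : y ∈ Icc a b := ⟨hx.trans hxy, hy⟩
    have hsub : Icc (f^[n] x) (f^[n] y) ⊆ Icc (f^[n] a) (f^[n] b) :=
      Icc_subset_Icc (h.image_subset hS hxI).1 (h.image_subset hS hyI).2
    rw [Function.iterate_succ_apply', Function.iterate_succ_apply']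
    exact mul_sub_le_of_le_deriv (S := Icc (f^[n] a) (f^[n] b))
      (fun z hz => h.differentiableAt (hdom hz)) (fun z hz => hm' z hz (hdom hz))
      ((h.strictMonoOn_iterate hS).monotoneOn hxI hyI hxy) hsub
  have hmono := h.strictMonoOn_iterate hS ha hb hab
  have hmono1 := h.strictMonoOn_iterate hS1 ha hb hab
  have hw0 : 0 < w := by
    have e1 := hw a b le_rfl hab.le le_rfl
    have e2 := sub_pos.2 hab
    have e3 := sub_pos.2 hmono
    exact pos_of_mul_pos_left (e2.trans_le e1) e3.le
  by_cases hle : f^[n + 1] b - f^[n + 1] a ≤ η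
  · refine ⟨[⟨a, b, w / m⟩], isFamily_singleton (u := ⟨a, b, w / m⟩) ⟨hab, hS1, hle, ?_⟩,
      by simp [mass], ?_⟩
    · intro x y hx hxy hy
      refine (hw x y hx hxy hy).trans ?_
      rw [div_mul_eq_mul_div, le_div_iff₀ hm, mul_assoc]
      refine mul_le_mul_of_nonneg_left ?_ hw0.le
      rw [mul_comm]
      exact hstep x y hx hxy hy
    · have : 0 ≤ 2 * Real.exp (4 * M) / η * (b - a) := by
        have := sub_pos.2 hab
        positivity
      simpa [weight] using this
  · rw [not_le] at hle
    obtain ⟨k, hk⟩ := pow_unbounded_of_one_lt ((f^[n + 1] b - f^[n + 1] a) / η)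
      (one_lt_two : (1 : ℝ) < 2)
    rw [div_lt_iff₀ hη0] at hk
    obtain ⟨L, hL, hLm, hLw⟩ := h.exists_subdivide hδ hη k hab hS1 (by linarith) hk.le
    refine ⟨L, hL, hLm, hLw.trans ?_⟩
    have : 0 < w / m := by positivity
    linarith

/-- One step of the dynamics: remove the points that fall into `(-δ, δ)` and subdivide. -/
theorem exists_step (h : LorenzBounds f α lam M ρ) (hδ : 0 < δ) (hη : η = δ ^ α)
    (hρ : δ + η ≤ ρ) {u : Piece} (hu : u.Good f δ η n) :
    ∃ L, IsFamily f δ η (n + 1) u.a u.b L ∧ u.b - u.a - 2 * δ * u.w ≤ mass L ∧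
      weight L ≤ 5 / 7 * u.w + 2 * Real.exp (4 * M) / η * mass L := by
  have hη0 : 0 < η := hη ▸ Real.rpow_pos_of_pos hδ α
  have hw0 := hu.weight_nonneg h
  have hl := h.le_lam
  obtain ⟨a, b, w⟩ := u
  obtain ⟨hab, hS, hlen, hw⟩ := hu
  simp only at hab hS hlen hw hw0 ⊢
  have ha : a ∈ Icc a b := left_mem_Icc.2 hab.le
  have hb : b ∈ Icc a b := right_mem_Icc.2 hab.le
  by_cases hside : δ ≤ f^[n] a ∨ f^[n] b ≤ -δ
  · obtain ⟨L, hL, hLm, hLw⟩ := h.exists_advance hδ hη hab hS hw hside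
      (show (0 : ℝ) < 7 / 5 by norm_num) (fun z _ hz => hl.trans (h.lam_le z hz))
    refine ⟨L, hL, ?_, ?_⟩
    · rw [hLm]
      have : 0 ≤ 2 * δ * w := by positivity
      linarith
    · rw [hLm]
      refine hLw.trans (le_of_eq ?_)
      ring
  · rw [not_or, not_le, not_le] at hside
    -- An image of length at most `η` that meets `(-δ, δ)` stays within `δ + η ≤ ρ` of the
    -- singularity, where the slope is at least `4`. Cutting out the hole may leave two pieces, but
    -- their weights add up to at most `2 / 4 ≤ 5 / 7` of the old one, apart from the length terms.
    have h4 : ∀ z ∈ Icc (f^[n] a) (f^[n] b), z ∈ domInt → 4 ≤ deriv f z := by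
      intro z hz hzd
      refine h.four_le z hzd ?_
      rw [abs_le]
      constructor <;> linarith [hz.1, hz.2]
    have left : ∃ b₁ L₁, a ≤ b₁ ∧ b₁ ≤ b ∧ -δ ≤ f^[n] b₁ ∧ (b₁ = a ∨ f^[n] b₁ = -δ) ∧
        IsFamily f δ η (n + 1) a b₁ L₁ ∧ mass L₁ = b₁ - a ∧
        weight L₁ ≤ w / 4 + 2 * Real.exp (4 * M) / η * (b₁ - a) := by
      by_cases hc : f^[n] a < -δ
      · obtain ⟨b₁, hb₁, hb₁'⟩ := h.surjOn hab.le hS ⟨hc.le, hside.2.le⟩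
        have hlt : a < b₁ := by
          refine lt_of_le_of_ne hb₁.1 ?_
          rintro rfl
          linarith
        obtain ⟨L, hL, hLm, hLw⟩ := h.exists_advance hδ hη hlt
          ((Icc_subset_Icc le_rfl hb₁.2).trans hS)
          (fun x y hx hxy hy => hw x y hx hxy (hy.trans hb₁.2)) (Or.inr hb₁'.le) four_pos
          (fun z hz => h4 z ⟨hz.1, hz.2.trans (h.image_subset hS hb₁).2⟩)
        exact ⟨b₁, L, hb₁.1, hb₁.2, hb₁'.ge, Or.inr hb₁', hL, hLm, hLw⟩
      -- Nothing lies to the left of the hole; the empty family takes the place of the left piece.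
      · refine ⟨a, [], le_rfl, hab.le, not_lt.1 hc, Or.inl rfl, isFamily_nil a a, ?_, ?_⟩
        · rw [mass_nil, sub_self]
        · rw [weight_nil, sub_self, mul_zero, add_zero]
          positivity
    have right : ∃ a₂ L₂, a ≤ a₂ ∧ a₂ ≤ b ∧ f^[n] a₂ ≤ δ ∧ (a₂ = b ∨ f^[n] a₂ = δ) ∧
        IsFamily f δ η (n + 1) a₂ b L₂ ∧ mass L₂ = b - a₂ ∧
        weight L₂ ≤ w / 4 + 2 * Real.exp (4 * M) / η * (b - a₂) := by
      by_cases hc : δ < f^[n] b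
      · obtain ⟨a₂, ha₂, ha₂'⟩ := h.surjOn hab.le hS ⟨hside.1.le, hc.le⟩
        have hlt : a₂ < b := by
          refine lt_of_le_of_ne ha₂.2 ?_
          rintro rfl
          linarith
        obtain ⟨L, hL, hLm, hLw⟩ := h.exists_advance hδ hη hlt
          ((Icc_subset_Icc ha₂.1 le_rfl).trans hS)
          (fun x y hx hxy hy => hw x y (ha₂.1.trans hx) hxy hy) (Or.inl ha₂'.ge) four_pos
          (fun z hz => h4 z ⟨(h.image_subset hS ha₂).1.trans hz.1, hz.2⟩)
        exact ⟨a₂, L, ha₂.1, ha₂.2, ha₂'.le, Or.inr ha₂', hL, hLm, hLw⟩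
      · refine ⟨b, [], hab.le, le_rfl, not_lt.1 hc, Or.inl rfl, isFamily_nil b b, ?_, ?_⟩
        · rw [mass_nil, sub_self]
        · rw [weight_nil, sub_self, mul_zero, add_zero]
          positivity
    obtain ⟨b₁, L₁, hab₁, hb₁b, hfb₁, hb₁, hL₁, hm₁, hw₁⟩ := left
    obtain ⟨a₂, L₂, haa₂, ha₂b, hfa₂, ha₂, hL₂, hm₂, hw₂⟩ := right
    have hle : b₁ ≤ a₂ := by
      rcases hb₁ with rfl | hb₁
      · exact haa₂
      rcases ha₂ with rfl | ha₂
      · exact hb₁b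
      · rw [← (h.strictMonoOn_iterate hS).le_iff_le ⟨hab₁, hb₁b⟩ ⟨haa₂, ha₂b⟩, hb₁, ha₂]
        linarith
    refine ⟨L₁ ++ L₂, hL₁.append hL₂ haa₂ hle hb₁b, ?_, ?_⟩
    · rw [mass_append, hm₁, hm₂]
      have e1 := hw b₁ a₂ hab₁ hle ha₂b
      have e2 : w * (f^[n] a₂ - f^[n] b₁) ≤ w * (2 * δ) := by
        gcongr
        linarith
      linarith
    · rw [weight_append, mass_append, hm₁, hm₂, mul_add]
      linarith

theorem exists_step_family (h : LorenzBounds f α lam M ρ) (hδ : 0 < δ) (hη : η = δ ^ α)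
    (hρ : δ + η ≤ ρ) (L : List Piece) (hL : L.Pairwise fun u v => u.b ≤ v.a)
    (hgood : ∀ u ∈ L, u.Good f δ η n) :
    ∃ L' : List Piece, L'.Pairwise (fun u v => u.b ≤ v.a) ∧
      (∀ u ∈ L', u.Good f δ η (n + 1) ∧ ∃ v ∈ L, v.a ≤ u.a ∧ u.b ≤ v.b) ∧
      mass L - 2 * δ * weight L ≤ mass L' ∧
      weight L' ≤ 5 / 7 * weight L + 2 * Real.exp (4 * M) / η * mass L' := by
  induction L with
  | nil => exact ⟨[], List.Pairwise.nil, by simp, by simp [mass, weight], by simp [mass, weight]⟩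
  | cons u L ih =>
    rw [List.pairwise_cons] at hL
    obtain ⟨L', h1, h2, h3, h4⟩ := ih hL.2 fun v hv => hgood v (List.mem_cons_of_mem _ hv)
    obtain ⟨L₁, hL₁, hm₁, hw₁⟩ := h.exists_step hδ hη hρ (hgood u List.mem_cons_self)
    refine ⟨L₁ ++ L', List.pairwise_append.2 ⟨hL₁.pairwise, h1, fun x hx y hy => ?_⟩,
      fun x hx => ?_, ?_, ?_⟩
    · obtain ⟨-, v, hv, hva, -⟩ := h2 y hy
      exact (hL₁.le_right x hx).trans ((hL.1 v hv).trans hva)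
    · rcases List.mem_append.1 hx with hx | hx
      · exact ⟨hL₁.good x hx, u, List.mem_cons_self, hL₁.left_le x hx, hL₁.le_right x hx⟩
      · obtain ⟨e1, v, hv, e2⟩ := h2 x hx
        exact ⟨e1, v, List.mem_cons_of_mem _ hv, e2⟩
    · rw [mass_append, mass_cons, weight_cons]
      linarith
    · rw [weight_append, mass_append, weight_cons, mul_add]
      linarith

/-- The mass of the surviving families decays slowly, and their weight is controlled by their
mass. -/
theorem exists_family (h : LorenzBounds f α lam M ρ) (hδ : 0 < δ) (hη : η = δ ^ α)
    (hρ : δ + η ≤ ρ) {ε a b : ℝ} (hε : ε ≤ 1 / 10)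
    (hδε : 2 * δ * (10 * Real.exp (4 * M) / η) ≤ ε) (ha : -1 / 2 < a) (hab : a + η ≤ b)
    (hb : b < 1 / 2) (n : ℕ) :
    ∃ L, IsFamily f δ η n a b L ∧ weight L ≤ 10 * Real.exp (4 * M) / η * mass L ∧
      (1 - ε) ^ n * η ≤ mass L := by
  have hη0 : 0 < η := hη ▸ Real.rpow_pos_of_pos hδ α
  set D := Real.exp (4 * M) with hD
  have hD1 : 1 ≤ D := Real.one_le_exp (by linarith [h.M_pos])
  induction n with
  | zero =>
    -- At time `0` the inverse branch is the identity, of weight `1`, and `1 ≤ 10 * D`.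
    refine ⟨[⟨a, a + η, 1⟩], ⟨List.pairwise_singleton _ _, ?_, by simp, by simpa using hab⟩, ?_, ?_⟩
    · intro u hu
      rw [List.mem_singleton] at hu
      subst hu
      refine ⟨by simpa using hη0, ?_, by simp, fun x y _ _ _ => by simp⟩
      intro x hx
      refine ⟨⟨ha.trans_le hx.1, ?_⟩, by simp⟩
      exact (hx.2.trans hab).trans_lt hb
    · simp only [weight, mass, List.map_cons, List.map_nil, List.sum_cons, List.sum_nil]
      have : 10 * D / η * (a + η - a + 0) = 10 * D := by
        field_simp
        ring
      rw [this]
      linarith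
    · simp [mass]
  | succ n ih =>
    obtain ⟨L, hL, hLw, hLm⟩ := ih
    obtain ⟨L', h1, h2, h3, h4⟩ := h.exists_step_family hδ hη hρ L hL.pairwise hL.good
    have hm0 : 0 < mass L := lt_of_lt_of_le
      (mul_pos (pow_pos (by linarith) n) hη0) hLm
    have e1 : 2 * δ * weight L ≤ ε * mass L := by
      calc 2 * δ * weight L ≤ 2 * δ * (10 * D / η * mass L) := by gcongr
        _ = 2 * δ * (10 * D / η) * mass L := by ring
        _ ≤ ε * mass L := by gcongr
    have e2 : (1 - ε) * mass L ≤ mass L' := by linarith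
    have e3 : mass L ≤ 10 / 9 * mass L' := by nlinarith
    have hDη : 0 < D / η := by positivity
    refine ⟨L', ⟨h1, fun u hu => (h2 u hu).1, fun u hu => ?_, fun u hu => ?_⟩, ?_, ?_⟩
    · obtain ⟨-, v, hv, hva, -⟩ := h2 u hu
      exact (hL.left_le v hv).trans hva
    · obtain ⟨-, v, hv, -, hvb⟩ := h2 u hu
      exact hvb.trans (hL.le_right v hv)
    · have e4 : weight L ≤ D / η * (10 * mass L) := by
        refine hLw.trans (le_of_eq ?_)
        ring
      have e5 : D / η * (10 * mass L) ≤ D / η * (100 / 9 * mass L') :=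
        mul_le_mul_of_nonneg_left (by linarith) hDη.le
      have e6 : 2 * D / η * mass L' = D / η * (2 * mass L') := by ring
      have e7 : 10 * D / η * mass L' = D / η * (10 * mass L') := by ring
      have e8 : 0 ≤ D / η * mass L' := mul_nonneg hDη.le (by nlinarith)
      rw [e6] at h4
      rw [e7]
      -- The constant `10` reproduces itself: `5 / 7 * 10 * (10 / 9) + 2 = 626 / 63 < 10`, where `10
      -- / 9` accounts for the lost mass.
      have e9 : 5 / 7 * (D / η * (100 / 9 * mass L')) + D / η * (2 * mass L') ≤
          D / η * (10 * mass L') := by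
        have e10 : D / η * (10 * mass L') - (5 / 7 * (D / η * (100 / 9 * mass L')) +
          D / η * (2 * mass L')) = 4 / 63 * (D / η * mass L') := by ring
        linarith
      linarith
    · rw [pow_succ']
      have : (1 - ε) * ((1 - ε) ^ n * η) ≤ (1 - ε) * mass L := by
        gcongr
        linarith
      linarith

end LorenzBounds

end Family

/-- The pieces whose image has length at least `η'` carry most of the mass. -/
theorem mass_le_mass_filter {f : ℝ → ℝ} {α lam M ρ δ η : ℝ} {n : ℕ}
    (h : LorenzBounds f α lam M ρ) {η' : ℝ} (hη' : 0 ≤ η')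
    (L : List Piece) (hgood : ∀ u ∈ L, u.Good f δ η n) [DecidablePred fun u : Piece =>
      η' ≤ f^[n] u.b - f^[n] u.a] :
    mass L ≤ mass (L.filter fun u => η' ≤ f^[n] u.b - f^[n] u.a) + η' * weight L := by
  induction L with
  | nil => simp [mass, weight]
  | cons u L ih =>
    have ih' := ih fun v hv => hgood v (List.mem_cons_of_mem _ hv)
    have hu := hgood u List.mem_cons_self
    have hw := hu.weight_nonneg h
    rw [mass_cons, weight_cons, mul_add]
    by_cases hlong : η' ≤ f^[n] u.b - f^[n] u.a
    · rw [List.filter_cons_of_pos (by simpa using hlong), mass_cons]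
      have := mul_nonneg hη' hw
      linarith
    · rw [List.filter_cons_of_neg (by simpa using hlong)]
      have e1 := hu.weight u.a u.b le_rfl hu.lt.le le_rfl
      have e2 : u.w * (f^[n] u.b - f^[n] u.a) ≤ u.w * η' := by
        gcongr
        exact (not_le.1 hlong).le
      linarith

/-! ### Horseshoes of dimension close to one -/

namespace LorenzBounds

variable {f : ℝ → ℝ} {α lam M ρ p q : ℝ}

/-- The choice of the size of the removed neighbourhood of the singularity. -/
theorem exists_params (h : LorenzBounds f α lam M ρ) {ε l : ℝ} (hε : 0 < ε) (hl : 0 < l) :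
    ∃ δ > 0, δ + δ ^ α ≤ ρ ∧ δ ^ α ≤ l ∧ 2 * δ * (10 * Real.exp (4 * M) / δ ^ α) ≤ ε := by
  have tend : ∀ β : ℝ, 0 < β → Tendsto (fun δ : ℝ => δ ^ β) (𝓝[>] 0) (𝓝 0) := by
    intro β hβ
    have := (Real.continuousAt_rpow_const 0 β (Or.inr hβ.le)).tendsto
    rw [Real.zero_rpow hβ.ne'] at this
    exact this.mono_left nhdsWithin_le_nhds
  have t1 := tend α h.alpha_pos
  have t2 := (tend (1 - α) (by linarith [h.alpha_lt_one])).const_mul (20 * Real.exp (4 * M))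
  have t0 : Tendsto (fun δ : ℝ => δ) (𝓝[>] 0) (𝓝 0) := nhdsWithin_le_nhds
  have t3 := t0.add t1
  rw [add_zero] at t3
  rw [mul_zero] at t2
  obtain ⟨δ, ⟨h1, h2⟩, h3, h4⟩ := (((t3.eventually_le_const h.rho_pos).and
    (t1.eventually_le_const hl)).and ((t2.eventually_le_const hε).and
    (self_mem_nhdsWithin : Ioi (0 : ℝ) ∈ 𝓝[>] 0))).exists
  have hδ : 0 < δ := h4
  refine ⟨δ, hδ, h1, h2, le_trans (le_of_eq ?_) h3⟩
  rw [Real.rpow_sub hδ, Real.rpow_one]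
  ring

/-- Inside every interval there are finitely many disjoint full branches onto `[p, q]`, whose
contraction rates `κ i` satisfy `∑ i, κ i ^ s ≥ 1`. -/
theorem exists_horseshoe (h : LorenzBounds f α lam M ρ) (hp : 0 < p) (hpq : p < q)
    (hq : q < 1 / 2) {s : ℝ} (hs1 : s < 1) {j₀ j₁ : ℝ} (hj₀ : -1 / 2 < j₀)
    (hj : j₀ < j₁) (hj₁ : j₁ < 1 / 2) :
    ∃ (r : ℕ) (a b κ : Fin r → ℝ) (N : Fin r → ℕ),
      (∀ i, j₀ ≤ a i ∧ a i < b i ∧ b i ≤ j₁) ∧ (∀ i j, i < j → b i ≤ a j) ∧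
      (∀ i, 1 ≤ N i ∧ Icc (a i) (b i) ⊆ survivors f 0 (N i) ∧
        f^[N i] (a i) = p ∧ f^[N i] (b i) = q) ∧
      (∀ i, 0 < κ i ∧ ∀ x y, a i ≤ x → x ≤ y → y ≤ b i →
        κ i * (f^[N i] y - f^[N i] x) ≤ y - x) ∧
      1 ≤ ∑ i, κ i ^ s := by
  classical
  -- `σ` is the gain per step from raising lengths to the power `s < 1`; `ε` is chosen so that the
  -- loss of mass does not cancel it.
  set σ : ℝ := (7 / 5 : ℝ) ^ (1 - s) with hσ
  have hσ1 : 1 < σ := Real.one_lt_rpow (by norm_num) (by linarith)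
  set ε := min (1 / 10) ((σ - 1) / (2 * σ)) with hε
  have hε0 : 0 < ε := lt_min (by norm_num) (div_pos (by linarith) (by linarith))
  have hε10 : ε ≤ 1 / 10 := min_le_left _ _
  have hτ : 1 < (1 - ε) * σ := by
    have e1 : ε * σ ≤ (σ - 1) / (2 * σ) * σ := by
      gcongr
      exact min_le_right _ _
    have e2 : (σ - 1) / (2 * σ) * σ = (σ - 1) / 2 := by field_simp
    linarith
  obtain ⟨δ, hδ, hδρ, hδj, hδε⟩ := h.exists_params hε0
    (show 0 < min 1 (j₁ - j₀) from lt_min one_pos (sub_pos.2 hj))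
  set η := δ ^ α with hη
  have hη0 : 0 < η := Real.rpow_pos_of_pos hδ α
  have hη1 : η ≤ 1 := hδj.trans (min_le_left _ _)
  have hηj : j₀ + η ≤ j₁ := by linarith [hδj.trans (min_le_right _ _)]
  set D := Real.exp (4 * M) with hD
  have hD0 : 0 < D := Real.exp_pos _
  -- With this threshold, the pieces with shorter image carry at most `η / (20 * D) * (10 * D / η) =
  -- 1 / 2` of the mass.
  obtain ⟨Λ, hΛ, hfull⟩ := h.hasFullBranch_uniform hp hpq hq
    (show 0 < η / (20 * D) by positivity)
  -- `Q` combines the Lipschitz constant of the final branch, the distortion and the maximal image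
  -- length. It is fixed before `n`, so a large `n` can absorb it.
  set Q := Λ * D * η with hQ
  have hQ0 : 0 < Q := by positivity
  obtain ⟨n, hn1, hn⟩ : ∃ n : ℕ, 1 ≤ n ∧ 2 * Q ^ s / η ≤ ((1 - ε) * σ) ^ n := by
    obtain ⟨n, hn⟩ := pow_unbounded_of_one_lt (2 * Q ^ s / η) hτ
    exact ⟨n + 1, by omega, hn.le.trans (pow_le_pow_right₀ hτ.le (by omega))⟩
  obtain ⟨L, hL, hLw, hLm⟩ := h.exists_family hδ hη hδρ hε10 hδε hj₀ hηj hj₁ n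
  set L' := L.filter fun u => η / (20 * D) ≤ f^[n] u.b - f^[n] u.a with hL'
  have hhalf : mass L ≤ 2 * mass L' := by
    have e1 := mass_le_mass_filter h (show 0 ≤ η / (20 * D) by positivity) L hL.good
    have e2 : η / (20 * D) * weight L ≤ η / (20 * D) * (10 * D / η * mass L) := by gcongr
    have e3 : η / (20 * D) * (10 * D / η * mass L) = mass L / 2 := by
      field_simp
      ring
    rw [← hL'] at e1
    linarith
  have hmem : ∀ u ∈ L', u ∈ L ∧ η / (20 * D) ≤ f^[n] u.b - f^[n] u.a := by
    intro u hu
    simpa [hL'] using hu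
  have hbranch : ∀ u ∈ L', ∃ (k : ℕ) (a b : ℝ), u.a ≤ a ∧ a < b ∧ b ≤ u.b ∧
      Icc a b ⊆ survivors f 0 (n + k) ∧ f^[n + k] a = p ∧ f^[n + k] b = q ∧
      ∀ x y, a ≤ x → x ≤ y → y ≤ b →
        (u.b - u.a) / Q * (f^[n + k] y - f^[n + k] x) ≤ y - x := by
    intro u hu
    obtain ⟨huL, hlong⟩ := hmem u hu
    have hg := hL.good u huL
    have hS := hg.subset
    have hS0 : Icc u.a u.b ⊆ survivors f 0 n := hS.trans (survivors_mono hδ.le le_rfl)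
    obtain ⟨k, c, d, h1, h2, h3, h4, h5, h6, h7⟩ := hfull (f^[n] u.a) (f^[n] u.b)
      (h.iterate_mem (hS (left_mem_Icc.2 hg.lt.le))).1 (by linarith)
      (h.iterate_mem (hS (right_mem_Icc.2 hg.lt.le))).2
    obtain ⟨a, b, ha, hab, hb, rfl, rfl⟩ := h.exists_pullback hg.lt.le hS h1 h2 h3
    have hsub := Icc_subset_Icc ha hb
    have hit : ∀ x, f^[n + k] x = f^[k] (f^[n] x) := fun x => by
      rw [add_comm, Function.iterate_add_apply]
    refine ⟨k, a, b, ha, hab, hb, fun x hx => mem_survivors_add (hS0 (hsub hx))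
      (h4 (h.image_subset (hsub.trans hS) hx)), by rw [hit, h5], by rw [hit, h6], ?_⟩
    intro x y hx hxy hy
    rcases hxy.eq_or_lt with rfl | hlt
    · simp
    have hxI : x ∈ Icc a b := ⟨hx, hxy.trans hy⟩
    have hyI : y ∈ Icc a b := ⟨hx.trans hxy, hy⟩
    have hm := h.strictMonoOn_iterate (hsub.trans hS)
    have e1 := h7 (f^[n] x) (f^[n] y) (h.image_subset (hsub.trans hS) hxI).1
      (hm.monotoneOn hxI hyI hxy) (h.image_subset (hsub.trans hS) hyI).2
    have e2 := h.distortion hδ hS hg.len (ha.trans hx) hlt (hy.trans hb) le_rfl hg.lt le_rfl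
    rw [← hD] at e2
    have e3 : 0 < u.b - u.a := sub_pos.2 hg.lt
    have e4 : 0 < y - x := sub_pos.2 hlt
    rw [hit, hit, div_mul_eq_mul_div, div_le_iff₀ hQ0]
    calc (u.b - u.a) * (f^[k] (f^[n] y) - f^[k] (f^[n] x))
        ≤ (u.b - u.a) * (Λ * (f^[n] y - f^[n] x)) := by gcongr
      _ = Λ * ((f^[n] y - f^[n] x) * (u.b - u.a)) := by ring
      _ ≤ Λ * (D * (f^[n] u.b - f^[n] u.a) * (y - x)) := by gcongr
      _ ≤ Λ * (D * η * (y - x)) := by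
        have := hg.len
        gcongr
      _ = (y - x) * Q := by rw [hQ]; ring
  have hmemL : ∀ i : Fin L'.length, L'[i.1] ∈ L' := fun i => List.getElem_mem i.2
  have hbr := fun i : Fin L'.length => hbranch _ (hmemL i)
  choose k a b hua hab hub hS hfa hfb hκ using hbr
  have hpw : L'.Pairwise fun u v => u.b ≤ v.a := hL.pairwise.filter _
  refine ⟨L'.length, a, b, fun i => (L'[i.1].b - L'[i.1].a) / Q, fun i => n + k i,
    fun i => ⟨(hL.left_le _ (hmem _ (hmemL i)).1).trans (hua i), hab i,
      (hub i).trans (hL.le_right _ (hmem _ (hmemL i)).1)⟩, fun i j hij => ?_,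
    fun i => ⟨hn1.trans (Nat.le_add_right _ _), hS i, hfa i, hfb i⟩,
    fun i => ⟨div_pos (sub_pos.2 (hL.good _ (hmem _ (hmemL i)).1).lt) hQ0, hκ i⟩, ?_⟩
  · exact ((hub i).trans (List.pairwise_iff_getElem.1 hpw i.1 j.1 i.2 j.2 hij)).trans (hua j)
  -- A piece of length `ℓ` satisfies `ℓ ≤ (5 / 7) ^ n`, so `ℓ ^ s = ℓ * ℓ ^ (s - 1) ≥ σ ^ n * ℓ`.
  -- The sum of the powers is thus bounded below by the mass.
  · have hterm : ∀ u ∈ L', σ ^ n / Q ^ s * (u.b - u.a) ≤ ((u.b - u.a) / Q) ^ s := by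
      intro u hu
      have hg := hL.good u (hmem u hu).1
      have hpos : 0 < u.b - u.a := sub_pos.2 hg.lt
      have e1 : (7 / 5 : ℝ) ^ n * (u.b - u.a) ≤ 1 := by
        have e2 := (h.pow_expand hg.lt.le hg.subset).trans (hg.len.trans hη1)
        refine le_trans ?_ e2
        have := h.le_lam
        gcongr
      have e3 : σ ^ n * (u.b - u.a) ^ (1 - s) ≤ 1 := by
        have e4 : σ ^ n = ((7 / 5 : ℝ) ^ n) ^ (1 - s) := by
          rw [hσ, ← Real.rpow_natCast, ← Real.rpow_natCast, ← Real.rpow_mul (by norm_num),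
            ← Real.rpow_mul (by norm_num), mul_comm]
        rw [e4, ← Real.mul_rpow (by positivity) hpos.le]
        exact Real.rpow_le_one (by positivity) e1 (by linarith)
      have e5 : u.b - u.a = (u.b - u.a) ^ s * (u.b - u.a) ^ (1 - s) := by
        rw [← Real.rpow_add hpos]
        simp
      have hQs : 0 < Q ^ s := Real.rpow_pos_of_pos hQ0 s
      have hus : 0 < (u.b - u.a) ^ s := Real.rpow_pos_of_pos hpos s
      rw [Real.div_rpow hpos.le hQ0.le, div_mul_eq_mul_div]
      gcongr
      calc σ ^ n * (u.b - u.a) = (u.b - u.a) ^ s * (σ ^ n * (u.b - u.a) ^ (1 - s)) := by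
            nth_rewrite 1 [e5]
            ring
        _ ≤ (u.b - u.a) ^ s * 1 := by gcongr
        _ = _ := mul_one _
    have hsum : σ ^ n / Q ^ s * mass L' ≤
        ∑ i : Fin L'.length, ((L'[i.1].b - L'[i.1].a) / Q) ^ s := by
      rw [Fin.sum_univ_fun_getElem L' fun u => ((u.b - u.a) / Q) ^ s, mass,
        ← List.sum_map_mul_left]
      exact List.sum_le_sum hterm
    refine le_trans ?_ hsum
    have hQs : 0 < Q ^ s := Real.rpow_pos_of_pos hQ0 s
    have e1 : (1 - ε) ^ n * η / 2 ≤ mass L' := by linarith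
    have e2 : 0 < σ ^ n / Q ^ s := by positivity
    refine le_trans ?_ (mul_le_mul_of_nonneg_left e1 e2.le)
    rw [mul_pow, div_le_iff₀ hη0] at hn
    have e3 : σ ^ n / Q ^ s * ((1 - ε) ^ n * η / 2) =
        ((1 - ε) ^ n * σ ^ n * η) / (2 * Q ^ s) := by
      field_simp
    rw [e3, le_div_iff₀ (by positivity), one_mul]
    exact hn

/-- Disjoint full branches onto `[p, q]` define a full branch system. -/
theorem isFullBranchSystem (h : LorenzBounds f α lam M ρ) {ι : Type*} {ψ : ℝ → ℝ} {a b : ι → ℝ}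
    {N : ι → ℕ} (hpa : ∀ i, p < a i) (hab : ∀ i, a i < b i) (hbq : ∀ i, b i < q)
    (hdisj : Pairwise fun i j => Disjoint (Ioo (a i) (b i)) (Ioo (a j) (b j)))
    (hN : ∀ i, 1 ≤ N i) (hS : ∀ i, Icc (a i) (b i) ⊆ survivors f 0 (N i))
    (ha : ∀ i, f^[N i] (a i) = p) (hb : ∀ i, f^[N i] (b i) = q)
    (hψ : ∀ i, ∀ x ∈ Ioo (a i) (b i), ψ x = f^[N i] x) :
    IsFullBranchSystem ψ lam p q a b where
  one_lt := h.one_lt_lam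
  left_lt := hpa
  lt := hab
  lt_right := hbq
  disjoint := hdisj
  continuousOn i := (h.continuousOn_iterate (Ioo_subset_Icc_self.trans (hS i))).congr (hψ i)
  mapsTo i x hx := by
    have hm := h.strictMonoOn_iterate (hS i)
    rw [hψ i x hx, ← ha i, ← hb i]
    exact ⟨hm (left_mem_Icc.2 (hab i).le) (Ioo_subset_Icc_self hx) hx.1,
      hm (Ioo_subset_Icc_self hx) (right_mem_Icc.2 (hab i).le) hx.2⟩
  surjOn i y hy := by
    rw [← ha i, ← hb i] at hy
    obtain ⟨x, hx, rfl⟩ := intermediate_value_Ioo (hab i).le (h.continuousOn_iterate (hS i)) hy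
    exact ⟨x, hx, hψ i x hx⟩
  expand i x hx y hy hxy := by
    rw [hψ i x hx, hψ i y hy]
    have e1 := h.pow_expand hxy ((Icc_subset_Icc hx.1.le hy.2.le).trans (hS i))
    have e2 : lam ^ 1 ≤ lam ^ N i := pow_le_pow_right₀ h.one_lt_lam.le (hN i)
    rw [pow_one] at e2
    exact (mul_le_mul_of_nonneg_right e2 (sub_nonneg.2 hxy)).trans e1

end LorenzBounds

/-! ### The increasing sequence of Cantor sets -/

theorem limitSet_mono {ψ : ℝ → ℝ} {ι ι' : Type*} {a b : ι → ℝ} {a' b' : ι' → ℝ}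
    (h : ∀ i, ∃ j, a i = a' j ∧ b i = b' j) : limitSet ψ a b ⊆ limitSet ψ a' b' := by
  intro x hx n
  obtain ⟨i, hi⟩ := mem_iUnion.1 (hx n)
  obtain ⟨j, hj₁, hj₂⟩ := h i
  rw [hj₁, hj₂] at hi
  exact mem_iUnion.2 ⟨j, hi⟩

end Lorenz

theorem theoremL (f : ℝ → ℝ) (α : ℝ) (hf : Lorenz.IsLorenzMap f α) :
    ∃ C : ℕ → Set ℝ, Monotone C ∧ (∀ k, Lorenz.IsRegularCantorSetFor f (C k)) ∧
      Tendsto (fun k => dimH (C k)) atTop (𝓝 1) := by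
  classical
  obtain ⟨lam, M, ρ, h⟩ := hf.exists_bounds
  -- horseshoes inside the disjoint intervals `[t (k + 1), t k]`
  set t : ℕ → ℝ := fun k => 1 / 8 + 1 / (8 * (k + 2)) with ht
  have ht1 : ∀ k, 1 / 8 < t k := fun k => by
    simp only [ht]
    have : (0 : ℝ) < 1 / (8 * (k + 2)) := by positivity
    linarith
  have ht_anti : StrictAnti t := by
    refine strictAnti_nat_of_succ_lt fun k => ?_
    simp only [ht]
    push_cast
    gcongr
    linarith
  have ht2 : ∀ k, t k < 3 / 8 := fun k => by
    have h0 : t 0 = 3 / 16 := by norm_num [ht]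
    exact (ht_anti.antitone (Nat.zero_le k)).trans_lt (by rw [h0]; norm_num)
  set s : ℕ → ℝ := fun k => 1 - 1 / (k + 2) with hs
  have hs0 : ∀ k, 0 < s k := fun k => by
    simp only [hs]
    have : (1 : ℝ) / (k + 2) < 1 := by
      rw [div_lt_one (by positivity)]
      have : (0 : ℝ) ≤ k := Nat.cast_nonneg k
      linarith
    linarith
  have hs1 : ∀ k, s k < 1 := fun k => by
    simp only [hs]
    have : (0 : ℝ) < 1 / (k + 2) := by positivity
    linarith
  -- All horseshoes have the common target `[1/8, 3/8]`, which contains the intervals in which they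
  -- are built; this is what allows their branches to be combined.
  have hh := fun k => h.exists_horseshoe (p := 1 / 8) (q := 3 / 8) (by norm_num) (by norm_num)
    (by norm_num) (hs1 k) (j₀ := t (k + 1)) (j₁ := t k) (by linarith [ht1 (k + 1)])
    (ht_anti (Nat.lt_succ_self k)) (by linarith [ht2 k])
  choose r a b κ N hab hord hbr hκ hsum using hh
  let A : (Σ k, Fin (r k)) → ℝ := fun i => a i.1 i.2
  let B : (Σ k, Fin (r k)) → ℝ := fun i => b i.1 i.2
  let n : (Σ k, Fin (r k)) → ℕ := fun i => N i.1 i.2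
  have hdisj : Pairwise fun i j => Disjoint (Ioo (A i) (B i)) (Ioo (A j) (B j)) := by
    have hle : ∀ {i j : Σ k, Fin (r k)}, B i ≤ A j →
        Disjoint (Ioo (A i) (B i)) (Ioo (A j) (B j)) := by
      intro i j hij
      refine disjoint_left.2 fun x hx hx' => ?_
      linarith [hx.2, hx'.1]
    rintro ⟨k, i⟩ ⟨l, j⟩ hij
    rcases lt_trichotomy k l with hkl | rfl | hkl
    · exact (hle (((hab l j).2.2.trans (ht_anti.antitone hkl)).trans (hab k i).1)).symm
    · have hne : i ≠ j := fun he => hij (by rw [he])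
      rcases lt_or_gt_of_ne hne with hlt | hlt
      · exact hle (hord k i j hlt)
      · exact (hle (hord k j i hlt)).symm
    · exact hle (((hab k i).2.2.trans (ht_anti.antitone hkl)).trans (hab l j).1)
  -- One map serves all the Cantor sets; its value outside the branches is irrelevant.
  let ψ : ℝ → ℝ := fun x => if hx : ∃ i, x ∈ Ioo (A i) (B i) then f^[n hx.choose] x else x
  have hψ : ∀ i, ∀ x ∈ Ioo (A i) (B i), ψ x = f^[n i] x := by
    intro i x hx
    have hex : ∃ i, x ∈ Ioo (A i) (B i) := ⟨i, hx⟩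
    have hi : hex.choose = i := by
      by_contra hne
      exact disjoint_left.1 (hdisj hne) hex.choose_spec hx
    simp only [ψ, dif_pos hex, hi]
  have hsys : ∀ {ι : Type} (g : ι → Σ k, Fin (r k)), Function.Injective g →
      Lorenz.IsFullBranchSystem ψ lam (1 / 8) (3 / 8) (A ∘ g) (B ∘ g) := by
    intro ι g hg
    exact h.isFullBranchSystem (N := n ∘ g)
      (fun i => (ht1 _).trans_le (hab _ _).1) (fun i => (hab _ _).2.1)
      (fun i => (hab _ _).2.2.trans_lt (ht2 _)) (fun i j hij => hdisj (hg.ne hij))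
      (fun i => (hbr _ _).1) (fun i => (hbr _ _).2.1) (fun i => (hbr _ _).2.2.1)
      (fun i => (hbr _ _).2.2.2) (fun i => hψ (g i))
  have hr : ∀ k, Nonempty (Fin (r k)) := by
    intro k
    by_contra hemp
    rw [not_nonempty_iff] at hemp
    have := hsum k
    simp only [Finset.univ_eq_empty, Finset.sum_empty] at this
    linarith
  -- the branches of the first `k + 2` horseshoes, indexed by `Fin (m k)`
  let m : ℕ → ℕ := fun k => Fintype.card (Σ j : Fin (k + 2), Fin (r j))
  let e : ∀ k, Fin (m k) ≃ Σ j : Fin (k + 2), Fin (r j) := fun k => (Fintype.equivFin _).symm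
  let g : ∀ k, Fin (m k) → Σ k, Fin (r k) := fun k i => Sigma.map Fin.val (fun _ => id) (e k i)
  have hg : ∀ k, Function.Injective (g k) := fun k =>
    (Fin.val_injective.sigma_map fun _ => Function.injective_id).comp (e k).injective
  have hmem : ∀ k l, l < k + 2 → ∀ i : Fin (r l), ∃ j, g k j = ⟨l, i⟩ := by
    intro k l hl i
    refine ⟨(e k).symm ⟨⟨l, hl⟩, i⟩, ?_⟩
    simp only [g]
    rw [Equiv.apply_symm_apply]
    rfl
  have hlow : ∀ k, ENNReal.ofReal (s k) ≤ dimH (Lorenz.limitSet ψ (A ∘ g k) (B ∘ g k)) := by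
    intro k
    have hinj : Function.Injective fun i : Fin (r k) => (⟨k, i⟩ : Σ k, Fin (r k)) :=
      fun i j hij => eq_of_heq (Sigma.mk.inj hij).2
    refine ((hsys _ hinj).le_dimH_limitSet (κ k) (fun i => (hκ k i).1) ?_ (hs0 k)
      (hsum k)).trans (dimH_mono (Lorenz.limitSet_mono fun i => ?_))
    · intro i x hx y hy hxy
      rw [hψ ⟨k, i⟩ x hx, hψ ⟨k, i⟩ y hy]
      exact (hκ k i).2 x y hx.1.le hxy hy.2.le
    · obtain ⟨j, hj⟩ := hmem k k (by omega) i
      exact ⟨j, by simp only [Function.comp_apply, hj], by simp only [Function.comp_apply, hj]⟩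
  refine ⟨fun k => Lorenz.limitSet ψ (A ∘ g k) (B ∘ g k), fun k l hkl => ?_, fun k => ?_, ?_⟩
  · refine Lorenz.limitSet_mono fun i => ?_
    obtain ⟨j, hj⟩ := hmem l (e k i).1 (by have := (e k i).1.2; omega) (e k i).2
    exact ⟨j, by rw [Function.comp_apply, Function.comp_apply, hj]; rfl, by rw [Function.comp_apply, Function.comp_apply, hj]; rfl⟩
  -- Taking `k + 2` horseshoes guarantees at least two branches even for `k = 0`, since each
  -- horseshoe is nonempty.
  · have hnt : Nontrivial (Fin (m k)) := by
      obtain ⟨i, hi⟩ := hmem k 0 (by omega) (hr 0).some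
      obtain ⟨j, hj⟩ := hmem k 1 (by omega) (hr 1).some
      refine ⟨i, j, ?_⟩
      rintro rfl
      rw [hi] at hj
      exact absurd (congrArg Sigma.fst hj) (by norm_num)
    have hC2 : ∀ i, ContDiffOn ℝ 2 ψ (Ioo ((A ∘ g k) i) ((B ∘ g k) i)) := by
      intro i
      refine ContDiffOn.congr (fun x hx => ?_) (hψ (g k i))
      exact (h.contDiffAt_iterate
        ((hbr _ _).2.1 (Ioo_subset_Icc_self hx))).contDiffWithinAt
    obtain ⟨c, d, hcd, hsub⟩ := (hsys (g k) (hg k)).isRegularCantorSetWith_limitSet hC2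
    refine ⟨m k, c, d, ψ, hcd, fun j => ⟨n (g k j), (hbr _ _).1, _, isOpen_Ioo, hsub j,
      fun x hx => ⟨fun i hi => ?_, hψ (g k j) x hx⟩⟩⟩
    exact Lorenz.domInt_subset_dom (((hbr _ _).2.1 (Ioo_subset_Icc_self hx)).2 i hi).1
  · have hup : ∀ S : Set ℝ, dimH S ≤ 1 := fun S =>
      (dimH_mono (subset_univ S)).trans_eq Real.dimH_univ
    have hslim : Tendsto s atTop (𝓝 1) := by
      have h1 : Tendsto (fun k : ℕ => (1 : ℝ) / (k + 2)) atTop (𝓝 0) := by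
        have := (tendsto_const_div_atTop_nhds_zero_nat (1 : ℝ)).comp (tendsto_add_atTop_nat 2)
        refine this.congr fun k => ?_
        simp
      have h2 := h1.const_sub 1
      rwa [sub_zero] at h2
    have hlim : Tendsto (fun k => ENNReal.ofReal (s k)) atTop (𝓝 1) := by
      have := (ENNReal.continuous_ofReal.tendsto 1).comp hslim
      rwa [ENNReal.ofReal_one] at this
    exact tendsto_of_tendsto_of_tendsto_of_le_of_le hlim tendsto_const_nhds hlow
      fun k => hup _
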